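/- For complex $\alpha$ and $z$ let $$J_\alpha(z)=\sum_{m=0}^\infty \frac{(-1)^m}{m!\,\Gamma(m+\alpha+1)}\Big(\frac z2\Big)^{2m+\alpha},\qquad I_\alpha(z)=i^{-\alpha}J_\alpha(iz)$$ be the Bessel and modified Bessel functions of the first kind (principal powers). Let $h\ge 1$ be an integer, let $a,b>0$, let $p\in\mathbb C$ with $\operatorname{Re}p>0$ and $h\,|\arg p|\le \frac{\pi}{2}$, and let $\nu\in\mathbb C$ with $\operatorname{Re}\nu>-\frac1h$. Then the generalized Weber integral $$\Upsilon(h)=\int_0^\infty x\,e^{-px^2}J_\nu(ax^h)J_\nu(bx^h)\,dx$$ and the $(h-1)$-fold integral below converge absolutely, and $$\Upsilon(h)=\frac{(2\pi)^{\frac{1-h}{2}}h^{\frac12}}{2p}\int_{(0,\infty)^{h-1}} I_\nu\Big[\Big(\frac hp\Big)^h\frac{ab}{2}\prod_{k=1}^{h-1}x_k\Big]\exp\Big[-\Big(\frac hp\Big)^h\frac{a^2+b^2}{4}\prod_{k=1}^{h-1}x_k\Big]\prod_{k=1}^{h-1}x_k^{\frac kh-1}e^{-x_k}\,dx_1\cdots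 dx_{h-1}.$$ In particular, for $h=1$ (where the $0$-fold integral is the value of its integrand with empty products equal to $1$) this is Weber's formula $$\int_0^\infty x\,e^{-px^2}J_\nu(ax)J_\nu(bx)\,dx=\frac1{2p}\exp\Big(-\frac{a^2+b^2}{4p}\Big)I_\nu\Big(\frac{ab}{2p}\Big).$$ -/

import Mathlib

open MeasureTheory Set

noncomputable section

/-- The Bessel function of the first kind, `J_α(z)`, by its power series (principal powers). -/
def besselJ (α z : ℂ) : ℂ :=
  ∑' m : ℕ, (-1) ^ m / ((m.factorial : ℂ) * Complex.Gamma ((m : ℂ) + α + 1)) *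
    (z / 2) ^ (2 * (m : ℂ) + α)

/-- The modified Bessel function of the first kind, `I_α(z) = i^{-α} J_α(i z)`. -/
def besselI (α z : ℂ) : ℂ :=
  Complex.I ^ (-α) * besselJ α (Complex.I * z)

/-- The integrand `x e^{-p x²} J_ν(a x^h) J_ν(b x^h)` of the generalized Weber integral. -/
def weberIntegrand (ν p : ℂ) (a b : ℝ) (h : ℕ) (x : ℝ) : ℂ :=
  (x : ℂ) * Complex.exp (-p * (x : ℂ) ^ 2) *
    besselJ ν ((a * x ^ h : ℝ) : ℂ) * besselJ ν ((b * x ^ h : ℝ) : ℂ)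

/-- The generalized Weber integral `Υ(h)`. -/
def weberIntegral (ν p : ℂ) (a b : ℝ) (h : ℕ) : ℂ :=
  ∫ x in Ioi (0 : ℝ), weberIntegrand ν p a b h x

/-- The integrand of the `(h - 1)`-fold integral. The variable `x_k`, `1 ≤ k ≤ h - 1`,
is the coordinate of `x` with index `k - 1`. -/
def foldIntegrand (ν p : ℂ) (a b : ℝ) (h : ℕ) (x : Fin (h - 1) → ℝ) : ℂ :=
  besselI ν (((h : ℂ) / p) ^ h * ((a : ℂ) * b / 2) * ((∏ k, x k : ℝ) : ℂ)) *
    Complex.exp (-(((h : ℂ) / p) ^ h * (((a : ℂ) ^ 2 + (b : ℂ) ^ 2) / 4) *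
      ((∏ k, x k : ℝ) : ℂ))) *
    ((∏ k, (x k ^ ((((k : ℕ) : ℝ) + 1) / (h : ℝ) - 1) * Real.exp (-(x k))) : ℝ) : ℂ)

end

/-! Write `F` for `besselEntire ν`; then `J_ν(z) = (z/2)^ν F(-z²/4)`, and `I_ν(z) = (z/2)^ν F(z²/4)`
when `Re z ≥ 0`. With `u = x²` the Weber integral becomes half the Laplace transform at `p` of
`g(u^h)`, where `g(s) = J_ν(a√s) J_ν(b√s)` is `besselProd`.

For `h = 1` and `p > 0`, both series are multiplied out and integrated term by term. The
Chu–Vandermonde identity resums the resulting double series to `e^{-A} e^{-B} F(AB)`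
(`hasSum_exp_mul_besselEntire`). This is Weber's formula: the Laplace transform of `g` is
`W(1/p)/p`, with `W` the function `weberKernel`. The identity theorem carries it to `Re p > 0`.

For `h ≥ 2` and `p > 0`, Weber's formula is read backwards: `W(ζ) = ∫ g(ζy) e^{-y} dy`. The multiple
integral is thus an unnormalized expectation of `g(c X₁⋯X_{h-1} Y)`, with `c = (h/p)^h`, independent
Gamma variables `X_k` of shape `k/h` and an exponential `Y`. Gauss's multiplication formula says
that `X₁⋯X_{h-1} Y` has the moments of `(U/h)^h`, `U` exponential. Since the moment-generating
function of the logarithm is finite near `0`, the laws agree (`integral_orthantWeight_smul`).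
Rescaling `u` gives the Laplace transform of `g(u^h)`, and the normalizing mass `∏ Γ(k/h)` gives the
prefactor.

Complex `p` is reached by the identity theorem in the open sector and by continuity on its boundary
rays (`laplace_mul_eq_kernelFold`). Domination there needs `|W(ζ)| ≤ C |ζ|^{Re ν}` on the closed
half-plane (`exists_norm_weberKernel_le`), which comes from Poisson's integral for `F` and requires
`Re ν > -1/2`. This holds when `h ≥ 2`; the case `h = 1` needs only Weber's formula. -/

/-! ### The entire function behind `J_ν` and `I_ν`. -/

/-- The entire function `w ↦ ∑ wᵐ / (m! Γ(m + ν + 1))`, through which the Bessel functions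
`J_ν` and `I_ν` are expressed. -/
noncomputable def besselEntire (ν w : ℂ) : ℂ :=
  ∑' m : ℕ, w ^ m / ((m.factorial : ℂ) * Complex.Gamma ((m : ℂ) + ν + 1))

lemma Gamma_nat_add_ne_zero {ν : ℂ} (hν : -1 < ν.re) (m : ℕ) :
    Complex.Gamma ((m : ℂ) + ν + 1) ≠ 0 := by
  apply Complex.Gamma_ne_zero_of_re_pos
  have : (0 : ℝ) ≤ m := Nat.cast_nonneg m
  simp only [Complex.add_re, Complex.natCast_re, Complex.one_re]
  linarith

lemma nat_add_ne_zero {ν : ℂ} (hν : -1 < ν.re) (m : ℕ) : (m : ℂ) + ν + 1 ≠ 0 := by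
  intro h0
  have := congrArg Complex.re h0
  have h1 : (0 : ℝ) ≤ m := Nat.cast_nonneg m
  simp only [Complex.add_re, Complex.natCast_re, Complex.one_re, Complex.zero_re] at this
  linarith

lemma Gamma_nat_succ_add {ν : ℂ} (hν : -1 < ν.re) (m : ℕ) :
    Complex.Gamma (((m + 1 : ℕ) : ℂ) + ν + 1) =
      ((m : ℂ) + ν + 1) * Complex.Gamma ((m : ℂ) + ν + 1) := by
  rw [← Complex.Gamma_add_one _ (nat_add_ne_zero hν m)]
  push_cast
  ring_nf

/-- Consecutive values of `ε^{-m} / Γ(m + ν + 1)` have ratio of modulus `ε⁻¹ / |m + ν + 1| → 0`, so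
the series converges absolutely and its sum bounds every term. -/
lemma exists_inv_Gamma_le {ν : ℂ} (hν : -1 < ν.re) {ε : ℝ} (hε : 0 < ε) :
    ∃ C : ℝ, 0 < C ∧ ∀ m : ℕ, ‖(Complex.Gamma ((m : ℂ) + ν + 1))⁻¹‖ ≤ C * ε ^ m := by
  have hs : Summable fun m : ℕ =>
      ‖(Complex.Gamma ((m : ℂ) + ν + 1))⁻¹‖ * (ε⁻¹) ^ m := by
    refine summable_of_ratio_test_tendsto_lt_one (l := 0) one_pos ?_ ?_
    · refine Filter.Eventually.of_forall fun m => ?_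
      exact mul_ne_zero (norm_ne_zero_iff.2 (inv_ne_zero (Gamma_nat_add_ne_zero hν m)))
        (pow_ne_zero _ (inv_ne_zero hε.ne'))
    · have h1 : Filter.Tendsto (fun m : ℕ => ε⁻¹ * ‖(m : ℂ) + ν + 1‖⁻¹) Filter.atTop
          (nhds (ε⁻¹ * 0)) := by
        refine Filter.Tendsto.const_mul _ (Filter.Tendsto.inv_tendsto_atTop ?_)
        refine Filter.tendsto_atTop_mono (f := fun m : ℕ => (m : ℝ) + (ν.re + 1)) (fun m => ?_) ?_
        · refine le_trans (le_of_eq ?_) (Complex.re_le_norm _)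
          simp [add_assoc]
        · exact Filter.tendsto_atTop_add_const_right _ _ tendsto_natCast_atTop_atTop
      rw [mul_zero] at h1
      refine h1.congr fun m => ?_
      have h2 := Gamma_nat_add_ne_zero hν m
      have h3 := nat_add_ne_zero hν m
      rw [Gamma_nat_succ_add hν, norm_mul, norm_norm, norm_mul, norm_norm, norm_inv, norm_inv,
        norm_mul, norm_pow, norm_pow, pow_succ, Real.norm_of_nonneg (inv_pos.2 hε).le]
      have h4 : ‖Complex.Gamma ((m : ℂ) + ν + 1)‖ ≠ 0 := by simpa using h2
      have h5 : ‖(m : ℂ) + ν + 1‖ ≠ 0 := by simpa using h3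
      field_simp
  refine ⟨(∑' m : ℕ, ‖(Complex.Gamma ((m : ℂ) + ν + 1))⁻¹‖ * (ε⁻¹) ^ m) + 1, ?_, fun m => ?_⟩
  · have : 0 ≤ ∑' m : ℕ, ‖(Complex.Gamma ((m : ℂ) + ν + 1))⁻¹‖ * (ε⁻¹) ^ m :=
      tsum_nonneg fun m => by positivity
    linarith
  · have h1 := hs.le_tsum m (fun j _ => by positivity)
    have h2 : ‖(Complex.Gamma ((m : ℂ) + ν + 1))⁻¹‖ =
        ‖(Complex.Gamma ((m : ℂ) + ν + 1))⁻¹‖ * (ε⁻¹) ^ m * ε ^ m := by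
      rw [mul_assoc, ← mul_pow, inv_mul_cancel₀ hε.ne', one_pow, mul_one]
    rw [h2]
    gcongr
    linarith

lemma norm_besselEntire_term_le {ν : ℂ} {C ε : ℝ}
    (hC : ∀ m : ℕ, ‖(Complex.Gamma ((m : ℂ) + ν + 1))⁻¹‖ ≤ C * ε ^ m) (w : ℂ) (m : ℕ) :
    ‖w ^ m / ((m.factorial : ℂ) * Complex.Gamma ((m : ℂ) + ν + 1))‖ ≤
      C * ((ε * ‖w‖) ^ m / m.factorial) := by
  have h := hC m
  rw [div_eq_mul_inv, mul_inv, norm_mul, norm_mul, norm_pow, norm_inv, Complex.norm_natCast]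
  calc ‖w‖ ^ m * ((m.factorial : ℝ)⁻¹ * ‖(Complex.Gamma ((m : ℂ) + ν + 1))⁻¹‖)
      ≤ ‖w‖ ^ m * ((m.factorial : ℝ)⁻¹ * (C * ε ^ m)) := by gcongr
    _ = C * ((ε * ‖w‖) ^ m / m.factorial) := by rw [mul_pow]; ring

lemma summable_norm_besselEntire {ν : ℂ} (hν : -1 < ν.re) (w : ℂ) :
    Summable fun m : ℕ => ‖w ^ m / ((m.factorial : ℂ) * Complex.Gamma ((m : ℂ) + ν + 1))‖ := by
  obtain ⟨C, -, hC⟩ := exists_inv_Gamma_le hν one_pos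
  exact Summable.of_nonneg_of_le (fun _ => norm_nonneg _)
    (norm_besselEntire_term_le hC w) ((Real.summable_pow_div_factorial _).mul_left C)

lemma hasSum_besselEntire {ν : ℂ} (hν : -1 < ν.re) (w : ℂ) :
    HasSum (fun m : ℕ => w ^ m / ((m.factorial : ℂ) * Complex.Gamma ((m : ℂ) + ν + 1)))
      (besselEntire ν w) :=
  (summable_norm_besselEntire hν w).of_norm.hasSum

/-- The freedom in `ε` is what makes the Laplace integrals converge for every `Re p > 0`, however
small. -/
lemma exists_norm_besselEntire_le {ν : ℂ} (hν : -1 < ν.re) {ε : ℝ} (hε : 0 < ε) :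
    ∃ C : ℝ, 0 < C ∧ ∀ w : ℂ, ‖besselEntire ν w‖ ≤ C * Real.exp (ε * ‖w‖) := by
  obtain ⟨C, hC0, hC⟩ := exists_inv_Gamma_le hν hε
  refine ⟨C, hC0, fun w => ?_⟩
  have h := (NormedSpace.expSeries_div_hasSum_exp (ε * ‖w‖)).mul_left C
  rw [← Real.exp_eq_exp_ℝ] at h
  exact tsum_of_norm_bounded h (norm_besselEntire_term_le hC w)

lemma differentiable_besselEntire {ν : ℂ} (hν : -1 < ν.re) :
    Differentiable ℂ (besselEntire ν) := by
  intro w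
  obtain ⟨C, hC0, hC⟩ := exists_inv_Gamma_le hν one_pos
  have hd : DifferentiableOn ℂ (besselEntire ν) (Metric.ball 0 (‖w‖ + 1)) := by
    refine Complex.differentiableOn_tsum_of_summable_norm
      (u := fun m : ℕ => C * ((‖w‖ + 1) ^ m / m.factorial))
      ((Real.summable_pow_div_factorial _).mul_left C) (fun m => ?_) Metric.isOpen_ball
      (fun m z hz => ?_)
    · exact ((differentiable_id.pow m).div_const _).differentiableOn
    · refine (norm_besselEntire_term_le hC z m).trans ?_
      rw [mem_ball_zero_iff] at hz
      rw [one_mul]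
      gcongr
  exact (hd w (by simp)).differentiableAt (Metric.isOpen_ball.mem_nhds (by simp))

lemma continuous_besselEntire {ν : ℂ} (hν : -1 < ν.re) : Continuous (besselEntire ν) :=
  (differentiable_besselEntire hν).continuous

lemma besselJ_eq (ν : ℂ) {z : ℂ} (hz : z ≠ 0) :
    besselJ ν z = (z / 2) ^ ν * besselEntire ν (-(z ^ 2 / 4)) := by
  rw [besselJ, besselEntire, ← tsum_mul_left]
  refine tsum_congr fun m => ?_
  have h2 : (2 * (m : ℂ)) = ((2 * m : ℕ) : ℂ) := by push_cast; ring
  rw [Complex.cpow_add _ _ (div_ne_zero hz two_ne_zero), h2, Complex.cpow_natCast, pow_mul,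
    neg_pow (z ^ 2 / 4)]
  have : (z / 2) ^ 2 = z ^ 2 / 4 := by ring
  rw [this]
  ring

lemma besselI_eq (ν : ℂ) {z : ℂ} (hz : z ≠ 0) (hre : 0 ≤ z.re) :
    besselI ν z = (z / 2) ^ ν * besselEntire ν (z ^ 2 / 4) := by
  rw [besselI, besselJ_eq ν (mul_ne_zero Complex.I_ne_zero hz)]
  have h1 : -((Complex.I * z) ^ 2 / 4) = z ^ 2 / 4 := by
    rw [mul_pow, Complex.I_sq]; ring
  have hz2 : z / 2 ≠ 0 := div_ne_zero hz two_ne_zero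
  -- For `Re z ≥ 0` the arguments of `i` and `z/2` add up to a value in `[0, π]`, so the principal
  -- logarithm is additive here.
  have hlog : Complex.log (Complex.I * z / 2) = Complex.log Complex.I + Complex.log (z / 2) := by
    rw [mul_div_assoc, Complex.log_mul Complex.I_ne_zero hz2]
    have h3 : |Complex.arg (z / 2)| ≤ Real.pi / 2 := by
      rw [Complex.abs_arg_le_pi_div_two_iff]
      rw [Complex.div_ofNat_re]
      positivity
    rw [Complex.arg_I, mem_Ioc]
    rw [abs_le] at h3
    constructor <;> linarith [Real.pi_pos, h3.1, h3.2]
  rw [h1, ← mul_assoc, Complex.cpow_def_of_ne_zero Complex.I_ne_zero,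
    Complex.cpow_def_of_ne_zero (div_ne_zero (mul_ne_zero Complex.I_ne_zero hz) two_ne_zero),
    Complex.cpow_def_of_ne_zero hz2, ← Complex.exp_add, hlog]
  ring_nf

/-! ### Chu–Vandermonde and the double series. -/

lemma ring_choose_add_nat {x : ℂ} (hx : -1 < x.re) (j : ℕ) :
    Ring.choose (x + j) j =
      ((j.factorial : ℂ))⁻¹ * (Complex.Gamma (x + 1 + j) / Complex.Gamma (x + 1)) := by
  have hz : ∀ k : ℕ, x + 1 ≠ -k := by
    intro k h0
    have := congrArg Complex.re h0
    have h1 : (0 : ℝ) ≤ k := Nat.cast_nonneg k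
    simp only [Complex.add_re, Complex.neg_re, Complex.natCast_re, Complex.one_re] at this
    linarith
  rw [Ring.choose_eq_smul, Polynomial.descPochhammer_smeval_eq_ascPochhammer,
    Polynomial.ascPochhammer_smeval_eq_eval, Complex.Gamma_add_nat_div_Gamma_eq _ hz, smul_eq_mul]
  congr 3
  ring

/-- The Chu–Vandermonde identity in terms of the Gamma function. -/
lemma Gamma_vandermonde {ν : ℂ} (hν : -1 < ν.re) (m n : ℕ) :
    Complex.Gamma ((m : ℂ) + n + ν + 1) / ((m.factorial * Complex.Gamma (m + ν + 1)) *
      (n.factorial * Complex.Gamma (n + ν + 1))) =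
    ∑ k ∈ (Finset.range (n + 1)).filter (· ≤ m),
      1 / (((m - k).factorial : ℂ) * (n - k).factorial *
        (k.factorial * Complex.Gamma (k + ν + 1))) := by
  have hre : ∀ k : ℕ, -1 < ((k : ℂ) + ν).re := fun k => by
    have h1 : (0 : ℝ) ≤ k := Nat.cast_nonneg k
    simp only [Complex.add_re, Complex.natCast_re]
    linarith
  have h := Ring.add_choose_eq (r := (m : ℂ)) (s := (n : ℂ) + ν) n (Commute.all _ _)
  rw [Finset.Nat.sum_antidiagonal_eq_sum_range_succ
    (fun i j => Ring.choose (m : ℂ) i * Ring.choose ((n : ℂ) + ν) j)] at h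
  have hL : Ring.choose ((m : ℂ) + (n + ν)) n = ((n.factorial : ℂ))⁻¹ *
      (Complex.Gamma (m + n + ν + 1) / Complex.Gamma (m + ν + 1)) := by
    have := ring_choose_add_nat (hre m) n
    rw [show (m : ℂ) + (n + ν) = m + ν + n by ring, this]
    congr 3
    ring
  have hR : ∀ k ∈ Finset.range (n + 1), Ring.choose ((n : ℂ) + ν) (n - k) =
      (((n - k).factorial : ℂ))⁻¹ *
        (Complex.Gamma (n + ν + 1) / Complex.Gamma (k + ν + 1)) := by
    intro k hk
    have hk' : k ≤ n := Nat.lt_succ_iff.1 (Finset.mem_range.1 hk)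
    have := ring_choose_add_nat (hre k) (n - k)
    rw [Nat.cast_sub hk'] at this
    rw [show (n : ℂ) + ν = k + ν + (n - k) by ring, this]
    congr 3
    ring
  rw [hL, Finset.sum_congr rfl fun k hk => by rw [hR k hk, Ring.choose_natCast]] at h
  have h2 : Complex.Gamma ((m : ℂ) + n + ν + 1) / ((m.factorial * Complex.Gamma (m + ν + 1)) *
      (n.factorial * Complex.Gamma (n + ν + 1))) = ((n.factorial : ℂ))⁻¹ *
      (Complex.Gamma (m + n + ν + 1) / Complex.Gamma (m + ν + 1)) *
      ((m.factorial : ℂ) * Complex.Gamma (n + ν + 1))⁻¹ := by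
    field_simp
  rw [h2, h, Finset.sum_mul, Finset.sum_filter]
  refine Finset.sum_congr rfl fun k _ => ?_
  split_ifs with hkm
  · have hm := Nat.choose_mul_factorial_mul_factorial hkm
    have hc : ((m.choose k : ℕ) : ℂ) * k.factorial * (m - k).factorial = m.factorial := by
      exact_mod_cast hm
    have hg := Gamma_nat_add_ne_zero hν n
    have hg' := Gamma_nat_add_ne_zero hν k
    have f1 : (k.factorial : ℂ) ≠ 0 := by exact_mod_cast k.factorial_ne_zero
    have f2 : ((m - k).factorial : ℂ) ≠ 0 := by exact_mod_cast (m - k).factorial_ne_zero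
    have f3 : ((n - k).factorial : ℂ) ≠ 0 := by exact_mod_cast (n - k).factorial_ne_zero
    have f4 : (m.factorial : ℂ) ≠ 0 := by exact_mod_cast m.factorial_ne_zero
    field_simp
    linear_combination hc
  · rw [Nat.choose_eq_zero_of_lt (not_le.1 hkm)]
    simp

/-- The absolutely convergent triple series of the right-hand product, indexed by `((i, j), k)`, is
regrouped along the fibres of `((i, j), k) ↦ (i + k, j + k)`. Each fibre is finite, and
`Gamma_vandermonde` evaluates its sum; the signs fit because `(AB)^k = (-A)^k (-B)^k`. -/
lemma hasSum_exp_mul_besselEntire {ν : ℂ} (hν : -1 < ν.re) (A B : ℂ) :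
    HasSum (fun q : ℕ × ℕ => (-A) ^ q.1 * (-B) ^ q.2 *
      (Complex.Gamma ((q.1 : ℂ) + q.2 + ν + 1) /
        ((q.1.factorial * Complex.Gamma (q.1 + ν + 1)) *
          (q.2.factorial * Complex.Gamma (q.2 + ν + 1)))))
      (Complex.exp (-A) * Complex.exp (-B) * besselEntire ν (A * B)) := by
  have hA := NormedSpace.expSeries_div_hasSum_exp (-A)
  have hB := NormedSpace.expSeries_div_hasSum_exp (-B)
  have nA := NormedSpace.norm_expSeries_div_summable (-A)
  have nB := NormedSpace.norm_expSeries_div_summable (-B)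
  rw [← Complex.exp_eq_exp_ℂ] at hA hB
  have nAB := nA.mul_norm nB
  have hAB := hA.mul hB nAB.of_norm
  have h := hAB.mul (hasSum_besselEntire hν (A * B))
    (nAB.mul_norm (summable_norm_besselEntire hν (A * B))).of_norm
  let g : (ℕ × ℕ) × ℕ → ℕ × ℕ := fun x => (x.1.1 + x.2, x.1.2 + x.2)
  refine ((Equiv.sigmaFiberEquiv g).hasSum_iff.2 h).sigma fun q => ?_
  obtain ⟨m, n⟩ := q
  let f : (ℕ × ℕ) × ℕ → ℂ := fun x => (-A) ^ x.1.1 / x.1.1.factorial *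
    ((-B) ^ x.1.2 / x.1.2.factorial) *
    ((A * B) ^ x.2 / ((x.2.factorial : ℂ) * Complex.Gamma ((x.2 : ℂ) + ν + 1)))
  change HasSum (f ∘ ((↑) : {x | g x = (m, n)} → (ℕ × ℕ) × ℕ)) _
  rw [hasSum_subtype_iff_indicator]
  let s : Finset ((ℕ × ℕ) × ℕ) := ((Finset.range (n + 1)).filter (· ≤ m)).image
    fun k => ((m - k, n - k), k)
  have hs : ∀ x ∉ s, ({x | g x = (m, n)} : Set _).indicator f x = 0 := by
    intro x hx
    refine indicator_of_notMem (fun hgx => hx ?_) f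
    obtain ⟨⟨i, j⟩, k⟩ := x
    simp only [mem_ofPred_eq, g, Prod.mk.injEq] at hgx
    simp only [s, Finset.mem_image, Finset.mem_filter, Finset.mem_range, Prod.mk.injEq]
    exact ⟨k, by omega, by omega, rfl⟩
  convert hasSum_sum_of_ne_finset_zero (L := .unconditional _) hs using 1
  rw [Finset.sum_image (fun k _ k' _ hk => (Prod.mk.inj hk).2), Gamma_vandermonde hν,
    Finset.mul_sum]
  refine Finset.sum_congr rfl fun k hk => ?_
  simp only [Finset.mem_filter, Finset.mem_range] at hk
  rw [indicator_of_mem]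
  · simp only [f]
    have e1 : (-A) ^ m = (-A) ^ (m - k) * (-A) ^ k := by rw [← pow_add]; congr 1; omega
    have e2 : (-B) ^ n = (-B) ^ (n - k) * (-B) ^ k := by rw [← pow_add]; congr 1; omega
    have e3 : (A * B) ^ k = (-A) ^ k * (-B) ^ k := by rw [← mul_pow]; ring
    rw [e1, e2, e3]
    simp only [div_eq_mul_inv, mul_inv]
    ring
  · simp only [mem_ofPred_eq, g, Prod.mk.injEq]
    omega

/-! ### Holomorphic parameter integrals and the identity theorem. -/

/-- Holomorphy of a parametric integral whose integrand is holomorphic in the parameter and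
locally dominated. -/
lemma differentiableOn_integral_of_locally_dominated {α : Type*} [MeasurableSpace α]
    {μ : Measure α} {U : Set ℂ} (hU : IsOpen U) {F : ℂ → α → ℂ}
    (hmeas : ∀ z ∈ U, AEStronglyMeasurable (F z) μ)
    (hdiff : ∀ᵐ x ∂μ, DifferentiableOn ℂ (fun z => F z x) U)
    (hbound : ∀ z ∈ U, ∃ V ∈ nhds z, ∃ bound : α → ℝ, Integrable bound μ ∧
      ∀ᵐ x ∂μ, ∀ w ∈ V, ‖F w x‖ ≤ bound x) :
    DifferentiableOn ℂ (fun z => ∫ x, F z x ∂μ) U := by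
  intro z₀ hz₀
  obtain ⟨V, hV, bound, hbi, hb⟩ := hbound z₀ hz₀
  obtain ⟨R, hR, hRV⟩ := Metric.mem_nhds_iff.1 (Filter.inter_mem hV (hU.mem_nhds hz₀))
  -- A third of `R` leaves room for a closed disc of radius `r` around every point of the `r`-ball;
  -- Cauchy's estimate on that disc bounds the derivative by `bound x / r`.
  let r : ℝ := R / 3
  have hr : 0 < r := by positivity
  have hsub : ∀ z ∈ Metric.ball z₀ r, Metric.closedBall z r ⊆ V ∩ U := by
    intro z hz w hw
    apply hRV
    rw [Metric.mem_ball] at hz ⊢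
    rw [Metric.mem_closedBall] at hw
    have := dist_triangle w z z₀
    have : R = 3 * r := by simp only [r]; ring
    linarith
  have hz₀m : z₀ ∈ Metric.ball z₀ r := Metric.mem_ball_self hr
  have hVU : ∀ z ∈ Metric.ball z₀ r, z ∈ V ∩ U := fun z hz =>
    hsub z hz (Metric.mem_closedBall_self hr.le)
  have hder : ∀ᵐ x ∂μ, ∀ z ∈ Metric.ball z₀ r,
      HasDerivAt (fun z => F z x) (deriv (fun z => F z x) z) z := by
    filter_upwards [hdiff] with x hx z hz
    exact (hx.differentiableAt (hU.mem_nhds (hVU z hz).2)).hasDerivAt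
  refine ((hasDerivAt_integral_of_dominated_loc_of_deriv_le (μ := μ)
    (F' := fun z x => deriv (fun z => F z x) z) (bound := fun x => bound x / r)
    (Metric.ball_mem_nhds z₀ hr) ?_ ?_ ?_ ?_ (hbi.div_const r)
    hder).2.differentiableAt).differentiableWithinAt
  · filter_upwards [Metric.ball_mem_nhds z₀ hr] with z hz
    exact hmeas z (hVU z hz).2
  · refine hbi.mono' (hmeas z₀ hz₀) ?_
    filter_upwards [hb] with x hx
    exact hx z₀ (hVU z₀ hz₀m).1
  -- The derivative at `z₀` is measurable in `x` as an a.e. limit of difference quotients. The steps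
  -- `r / (n + 2)` are strictly less than `r` already at `n = 0`.
  · have hε : ∀ n : ℕ, z₀ + ((r / (n + 2) : ℝ) : ℂ) ∈ Metric.ball z₀ r := by
      intro n
      rw [mem_ball_iff_norm, add_sub_cancel_left, Complex.norm_real,
        Real.norm_of_nonneg (by positivity), div_lt_iff₀ (by positivity)]
      have : (0 : ℝ) ≤ n := Nat.cast_nonneg n
      nlinarith
    have h0 : Filter.Tendsto (fun n : ℕ => ((r / (n + 2) : ℝ) : ℂ)) Filter.atTop (nhds 0) := by
      rw [← Complex.ofReal_zero]
      refine (Complex.continuous_ofReal.tendsto 0).comp ?_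
      exact Filter.Tendsto.div_atTop tendsto_const_nhds
        (Filter.tendsto_atTop_add_const_right _ _ tendsto_natCast_atTop_atTop)
    refine aestronglyMeasurable_of_tendsto_ae Filter.atTop
      (f := fun (n : ℕ) x => (((r / (n + 2) : ℝ) : ℂ))⁻¹ •
        (F (z₀ + ((r / (n + 2) : ℝ) : ℂ)) x - F z₀ x)) (fun n => ?_) ?_
    · exact ((hmeas _ (hVU _ (hε n)).2).sub (hmeas _ hz₀)).const_mul _
    · filter_upwards [hder] with x hx
      have h1 := hasDerivAt_iff_tendsto_slope_zero.1 (hx z₀ hz₀m)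
      refine h1.comp (tendsto_nhdsWithin_iff.2 ⟨h0, Filter.Eventually.of_forall fun n => ?_⟩)
      simp only [mem_compl_iff, mem_singleton_iff, Complex.ofReal_eq_zero]
      positivity
  · filter_upwards [hb, hdiff] with x hx hd z hz
    refine Complex.norm_deriv_le_of_forall_mem_sphere_norm_le hr ?_ fun w hw => ?_
    · refine DifferentiableOn.diffContOnCl ?_
      exact hd.mono ((Metric.closure_ball_subset_closedBall.trans (hsub z hz)).trans
        inter_subset_right)
    · exact hx w (hsub z hz (Metric.sphere_subset_closedBall hw)).1

lemma norm_exp_neg_mul_ofReal (p : ℂ) (u : ℝ) :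
    ‖Complex.exp (-(p * u))‖ = Real.exp (-(p.re * u)) := by
  rw [Complex.norm_exp]
  simp

lemma aestronglyMeasurable_exp_neg_mul (p : ℂ) (μ : Measure ℝ) :
    AEStronglyMeasurable (fun u : ℝ => Complex.exp (-(p * u))) μ :=
  Continuous.aestronglyMeasurable (by fun_prop)

lemma integrableOn_laplace {f : ℝ → ℂ}
    (hf : ∀ ε : ℝ, 0 < ε → IntegrableOn (fun u : ℝ => Complex.exp (-((ε : ℂ) * u)) * f u) (Ioi 0))
    (hm : AEStronglyMeasurable f (volume.restrict (Ioi 0)))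
    {p : ℂ} (hp : 0 < p.re) :
    IntegrableOn (fun u : ℝ => Complex.exp (-(p * u)) * f u) (Ioi 0) := by
  refine (hf _ hp).norm.mono' ((aestronglyMeasurable_exp_neg_mul p _).mul hm) ?_
  refine ae_of_all _ fun u => ?_
  rw [norm_mul, norm_mul, norm_exp_neg_mul_ofReal, norm_exp_neg_mul_ofReal, Complex.ofReal_re]

/-- The Laplace transform is holomorphic in the right half-plane. -/
lemma differentiableOn_laplace {f : ℝ → ℂ}
    (hf : ∀ ε : ℝ, 0 < ε → IntegrableOn (fun u : ℝ => Complex.exp (-((ε : ℂ) * u)) * f u) (Ioi 0))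
    (hm : AEStronglyMeasurable f (volume.restrict (Ioi 0))) :
    DifferentiableOn ℂ (fun p : ℂ => ∫ u in Ioi (0 : ℝ), Complex.exp (-(p * u)) * f u)
      {p : ℂ | 0 < p.re} := by
  refine differentiableOn_integral_of_locally_dominated
    (isOpen_lt continuous_const Complex.continuous_re) (fun p _ => ?_) (ae_of_all _ fun u => ?_)
    fun p hp => ?_
  · exact (aestronglyMeasurable_exp_neg_mul p _).mul hm
  · exact Differentiable.differentiableOn (by fun_prop)
  · have hp' : 0 < p.re := hp
    refine ⟨{w | p.re / 2 < w.re}, (isOpen_lt continuous_const Complex.continuous_re).mem_nhds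
      (by simp only [mem_ofPred_eq]; linarith), _, (hf (p.re / 2) (by linarith)).norm, ?_⟩
    refine (ae_restrict_iff' measurableSet_Ioi).2 (ae_of_all _ fun u hu w hw => ?_)
    have hu' : 0 < u := hu
    have hw' : p.re / 2 < w.re := hw
    rw [norm_mul, norm_mul, norm_exp_neg_mul_ofReal, norm_exp_neg_mul_ofReal, Complex.ofReal_re]
    gcongr

lemma frequently_eq_of_eventually_eq_ofReal {f g : ℂ → ℂ} {x₀ : ℝ}
    (h : ∀ᶠ x : ℝ in nhds x₀, f x = g x) :
    ∃ᶠ z in nhdsWithin (x₀ : ℂ) {(x₀ : ℂ)}ᶜ, f z = g z := by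
  have ht : Filter.Tendsto ((↑) : ℝ → ℂ) (nhdsWithin x₀ {x₀}ᶜ)
      (nhdsWithin (x₀ : ℂ) {(x₀ : ℂ)}ᶜ) := by
    refine tendsto_nhdsWithin_iff.2 ⟨(Complex.continuous_ofReal.tendsto x₀).mono_left
      nhdsWithin_le_nhds, ?_⟩
    filter_upwards [self_mem_nhdsWithin] with x hx
    simpa using hx
  exact ht.frequently (h.filter_mono nhdsWithin_le_nhds).frequently

/-- Two functions holomorphic in the right half-plane that agree on the positive reals agree. -/
lemma eqOn_re_pos_of_eq_real {f g : ℂ → ℂ} (hf : DifferentiableOn ℂ f {p : ℂ | 0 < p.re})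
    (hg : DifferentiableOn ℂ g {p : ℂ | 0 < p.re})
    (h : ∀ p : ℝ, 0 < p → f p = g p) : EqOn f g {p : ℂ | 0 < p.re} := by
  have ho : IsOpen {p : ℂ | 0 < p.re} := isOpen_lt continuous_const Complex.continuous_re
  refine (hf.analyticOnNhd ho).eqOn_of_preconnected_of_frequently_eq (hg.analyticOnNhd ho)
    (convex_halfSpace_re_gt 0).isPreconnected (z₀ := ((1 : ℝ) : ℂ)) (by simp) ?_
  refine frequently_eq_of_eventually_eq_ofReal ?_
  filter_upwards [lt_mem_nhds one_pos] with p hp using h p hp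

/-! ### Weber's formula as a Laplace transform. -/

/-- The product `J_ν(a √s) J_ν(b √s)`. -/
noncomputable def besselProd (ν : ℂ) (a b : ℝ) (s : ℝ) : ℂ :=
  besselJ ν ((a * √s : ℝ) : ℂ) * besselJ ν ((b * √s : ℝ) : ℂ)

/-- The function `I_ν(ζ a b / 2) exp(-ζ (a² + b²) / 4)`. -/
noncomputable def weberKernel (ν : ℂ) (a b : ℝ) (ζ : ℂ) : ℂ :=
  besselI ν (ζ * ((a : ℂ) * b / 2)) * Complex.exp (-(ζ * (((a : ℂ) ^ 2 + (b : ℂ) ^ 2) / 4)))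

/-- The two factors `(√s)^ν` combine to `s^ν`, and `F` sees only squares, so no square root
survives. Powers of positive reals multiply without branch corrections. -/
lemma besselProd_eq (ν : ℂ) {a b s : ℝ} (ha : 0 < a) (hb : 0 < b) (hs : 0 < s) :
    besselProd ν a b s = ((a * b / 4 : ℝ) : ℂ) ^ ν * ((s : ℂ) ^ ν *
      (besselEntire ν (-((a ^ 2 / 4 : ℝ) * (s : ℂ))) *
        besselEntire ν (-((b ^ 2 / 4 : ℝ) * (s : ℂ))))) := by
  have hs' : 0 < √s := Real.sqrt_pos.2 hs
  have hsq : ((√s : ℝ) : ℂ) ^ 2 = s := by exact_mod_cast Real.sq_sqrt hs.le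
  have key : ∀ c : ℝ, 0 < c → besselJ ν ((c * √s : ℝ) : ℂ) =
      ((c * √s / 2 : ℝ) : ℂ) ^ ν * besselEntire ν (-((c ^ 2 / 4 : ℝ) * (s : ℂ))) := by
    intro c hc
    rw [besselJ_eq ν (by exact_mod_cast (mul_pos hc hs').ne')]
    congr 2
    · push_cast; ring
    · push_cast
      rw [mul_pow, hsq]; ring
  have hp : ((a * √s / 2 : ℝ) : ℂ) ^ ν * ((b * √s / 2 : ℝ) : ℂ) ^ ν =
      ((a * b / 4 : ℝ) : ℂ) ^ ν * (s : ℂ) ^ ν := by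
    rw [← Complex.mul_cpow_ofReal_nonneg (by positivity) (by positivity),
      ← Complex.mul_cpow_ofReal_nonneg (by positivity) hs.le, ← Complex.ofReal_mul,
      ← Complex.ofReal_mul]
    congr 2
    calc a * √s / 2 * (b * √s / 2) = a * b / 4 * (√s) ^ 2 := by ring
      _ = a * b / 4 * s := by rw [Real.sq_sqrt hs.le]
  rw [besselProd, key a ha, key b hb]
  calc _ = (((a * √s / 2 : ℝ) : ℂ) ^ ν * ((b * √s / 2 : ℝ) : ℂ) ^ ν) *
      (besselEntire ν (-((a ^ 2 / 4 : ℝ) * (s : ℂ))) *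
        besselEntire ν (-((b ^ 2 / 4 : ℝ) * (s : ℂ)))) := by ring
    _ = _ := by rw [hp]; ring

lemma ofReal_mul_cpow {r : ℝ} (hr : 0 < r) {z : ℂ} (hz : z ≠ 0) (ν : ℂ) :
    ((r : ℂ) * z) ^ ν = (r : ℂ) ^ ν * z ^ ν := by
  have hr' : (r : ℂ) ≠ 0 := by exact_mod_cast hr.ne'
  rw [Complex.cpow_def_of_ne_zero (mul_ne_zero hr' hz), Complex.cpow_def_of_ne_zero hr',
    Complex.cpow_def_of_ne_zero hz, Complex.log_ofReal_mul hr hz, Complex.ofReal_log hr.le,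
    add_mul, Complex.exp_add]

lemma weberKernel_eq (ν : ℂ) {a b : ℝ} (ha : 0 < a) (hb : 0 < b) {ζ : ℂ} (hζ : ζ ≠ 0)
    (hre : 0 ≤ ζ.re) :
    weberKernel ν a b ζ = ((a * b / 4 : ℝ) : ℂ) ^ ν * (ζ ^ ν *
      (besselEntire ν ((ζ * (a * b / 2 : ℝ)) ^ 2 / 4) *
        Complex.exp (-(ζ * (((a : ℂ) ^ 2 + (b : ℂ) ^ 2) / 4))))) := by
  have hab : ((a * b / 2 : ℝ) : ℂ) ≠ 0 := by exact_mod_cast (by positivity : a * b / 2 ≠ 0)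
  have e : ζ * ((a : ℂ) * b / 2) = ζ * ((a * b / 2 : ℝ) : ℂ) := by push_cast; ring
  have e2 : ζ * ((a * b / 2 : ℝ) : ℂ) / 2 = ((a * b / 4 : ℝ) : ℂ) * ζ := by push_cast; ring
  rw [weberKernel, e, besselI_eq ν (mul_ne_zero hζ hab), e2,
    ofReal_mul_cpow (by positivity) hζ]
  · ring
  · rw [Complex.re_mul_ofReal]; positivity

lemma integrableOn_rpow_mul_exp_neg {s b : ℝ} (hs : -1 < s) (hb : 0 < b) :
    IntegrableOn (fun x : ℝ => x ^ s * Real.exp (-(b * x))) (Ioi 0) := by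
  have := integrableOn_rpow_mul_exp_neg_mul_rpow hs one_pos hb
  simpa [Real.rpow_one] using this

lemma continuousOn_ofReal_cpow (ν : ℂ) : ContinuousOn (fun u : ℝ => (u : ℂ) ^ ν) (Ioi 0) :=
  fun u hu => ((Complex.continuousAt_ofReal_cpow_const u ν (Or.inr (ne_of_gt hu)))).continuousWithinAt

lemma exists_norm_entire_prod_le {ν : ℂ} (hν : -1 < ν.re) {α β : ℝ} (hα : 0 ≤ α) (hβ : 0 ≤ β)
    {ε : ℝ} (hε : 0 < ε) :
    ∃ C : ℝ, 0 < C ∧ ∀ u : ℝ, 0 < u →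
      ‖(u : ℂ) ^ ν * (besselEntire ν (-((α : ℂ) * u)) * besselEntire ν (-((β : ℂ) * u)))‖ ≤
        C * (u ^ ν.re * Real.exp (ε * u)) := by
  -- The two growth rates then add to `ε(α + β)/(α + β + 1) ≤ ε`; the `1` also covers `α = β = 0`.
  have hδ : 0 < ε / (α + β + 1) := by positivity
  obtain ⟨C, hC, hF⟩ := exists_norm_besselEntire_le hν hδ
  refine ⟨C * C, by positivity, fun u hu => ?_⟩
  have hn : ∀ c : ℝ, 0 ≤ c → ‖-((c : ℂ) * u)‖ = c * u := fun c hc => by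
    rw [norm_neg, ← Complex.ofReal_mul, Complex.norm_real, Real.norm_of_nonneg (by positivity)]
  rw [norm_mul, norm_mul, Complex.norm_cpow_eq_rpow_re_of_pos hu]
  have h1 := hF (-((α : ℂ) * u))
  have h2 := hF (-((β : ℂ) * u))
  rw [hn _ hα] at h1
  rw [hn _ hβ] at h2
  calc u ^ ν.re * (‖besselEntire ν (-((α : ℂ) * u))‖ * ‖besselEntire ν (-((β : ℂ) * u))‖)
      ≤ u ^ ν.re * ((C * Real.exp (ε / (α + β + 1) * (α * u))) *
          (C * Real.exp (ε / (α + β + 1) * (β * u)))) := by gcongr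
    _ = C * C * (u ^ ν.re * Real.exp (ε * ((α + β) / (α + β + 1)) * u)) := by
        rw [show ε * ((α + β) / (α + β + 1)) * u = ε / (α + β + 1) * (α * u) +
          ε / (α + β + 1) * (β * u) by ring, Real.exp_add]
        ring
    _ ≤ C * C * (u ^ ν.re * Real.exp (ε * u)) := by
        gcongr
        refine mul_le_of_le_one_right hε.le ?_
        rw [div_le_one (by positivity)]
        linarith

lemma aestronglyMeasurable_entire_prod {ν : ℂ} (hν : -1 < ν.re) (α β : ℝ) :
    AEStronglyMeasurable (fun u : ℝ => (u : ℂ) ^ ν *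
      (besselEntire ν (-((α : ℂ) * u)) * besselEntire ν (-((β : ℂ) * u))))
      (volume.restrict (Ioi 0)) := by
  refine ContinuousOn.aestronglyMeasurable ?_ measurableSet_Ioi
  have := continuous_besselEntire hν
  exact (continuousOn_ofReal_cpow ν).mul (Continuous.continuousOn (by fun_prop))

lemma integrableOn_exp_mul_entire_prod {ν : ℂ} (hν : -1 < ν.re) {α β : ℝ} (hα : 0 ≤ α)
    (hβ : 0 ≤ β) {p : ℝ} (hp : 0 < p) :
    IntegrableOn (fun u : ℝ => Complex.exp (-((p : ℂ) * u)) * ((u : ℂ) ^ ν *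
      (besselEntire ν (-((α : ℂ) * u)) * besselEntire ν (-((β : ℂ) * u))))) (Ioi 0) := by
  obtain ⟨C, hC, h⟩ := exists_norm_entire_prod_le hν hα hβ (half_pos hp)
  refine Integrable.mono' ((integrableOn_rpow_mul_exp_neg hν (half_pos hp)).const_mul C)
    ((aestronglyMeasurable_exp_neg_mul p _).mul (aestronglyMeasurable_entire_prod hν α β)) ?_
  refine (ae_restrict_iff' measurableSet_Ioi).2 (ae_of_all _ fun u hu => ?_)
  rw [norm_mul, norm_exp_neg_mul_ofReal, Complex.ofReal_re]
  calc _ ≤ Real.exp (-(p * u)) * (C * (u ^ ν.re * Real.exp (p / 2 * u))) := by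
        gcongr
        exact h u hu
    _ = C * (u ^ ν.re * (Real.exp (-(p * u)) * Real.exp (p / 2 * u))) := by ring
    _ = C * (u ^ ν.re * Real.exp (-(p / 2 * u))) := by
        rw [← Real.exp_add]
        congr 3
        ring

/-- Expanding both factors, each term is a Gamma integral contributing `Γ(m + n + ν + 1)`. The
result is the double series of `hasSum_exp_mul_besselEntire` with `A = α/p`, `B = β/p`. -/
lemma integral_exp_mul_entire_prod {ν : ℂ} (hν : -1 < ν.re) {α β : ℝ} (hα : 0 ≤ α)
    (hβ : 0 ≤ β) {p : ℝ} (hp : 0 < p) :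
    ∫ u in Ioi (0 : ℝ), Complex.exp (-((p : ℂ) * u)) * ((u : ℂ) ^ ν *
      (besselEntire ν (-((α : ℂ) * u)) * besselEntire ν (-((β : ℂ) * u)))) =
    (1 / (p : ℂ)) ^ (ν + 1) * (Complex.exp (-(α / p : ℂ)) * Complex.exp (-(β / p : ℂ)) *
      besselEntire ν (α / p * (β / p))) := by
  have hp' : (p : ℂ) ≠ 0 := by exact_mod_cast hp.ne'
  let t : ℂ → ℕ → ℂ := fun w m => w ^ m / ((m.factorial : ℂ) * Complex.Gamma ((m : ℂ) + ν + 1))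
  -- With this `δ` the dominating double exponential series grows like `e^{δ(α + β)u}` with `δ(α +
  -- β) ≤ p/2`, so `e^{-pu}` still wins.
  let δ : ℝ := p / 2 / (α + β + 1)
  have hδ : 0 < δ := by positivity
  obtain ⟨C, hC, hG⟩ := exists_inv_Gamma_le hν hδ
  have hn : ∀ c : ℝ, 0 ≤ c → ∀ u : ℝ, 0 < u → ‖-((c : ℂ) * u)‖ = c * u := fun c hc u hu => by
    rw [norm_neg, ← Complex.ofReal_mul, Complex.norm_real, Real.norm_of_nonneg (by positivity)]
  let e : ℝ → ℕ → ℝ := fun x m => C * (x ^ m / m.factorial)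
  have he : ∀ x, HasSum (e x) (C * Real.exp x) := fun x => by
    have h := (NormedSpace.expSeries_div_hasSum_exp x).mul_left C
    rwa [← Real.exp_eq_exp_ℝ] at h
  have hesum : ∀ x, 0 ≤ x → Summable fun m => ‖e x m‖ := fun x hx => by
    refine (he x).summable.congr fun m => ?_
    rw [Real.norm_of_nonneg]
    positivity
  have hee : ∀ u : ℝ, 0 < u → HasSum
      (fun q : ℕ × ℕ => Real.exp (-(p * u)) * (u ^ ν.re *
        (e (δ * (α * u)) q.1 * e (δ * (β * u)) q.2)))
      (Real.exp (-(p * u)) * (u ^ ν.re *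
        ((C * Real.exp (δ * (α * u))) * (C * Real.exp (δ * (β * u)))))) := fun u hu =>
    ((((he _).mul (he _) ((hesum _ (by positivity)).mul_norm
      (hesum _ (by positivity))).of_norm)).mul_left _).mul_left _
  have key := hasSum_integral_of_dominated_convergence (μ := volume.restrict (Ioi (0 : ℝ)))
    (F := fun (q : ℕ × ℕ) (u : ℝ) => Complex.exp (-((p : ℂ) * u)) * ((u : ℂ) ^ ν *
      (t (-((α : ℂ) * u)) q.1 * t (-((β : ℂ) * u)) q.2)))
    (f := fun u : ℝ => Complex.exp (-((p : ℂ) * u)) * ((u : ℂ) ^ ν *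
      (besselEntire ν (-((α : ℂ) * u)) * besselEntire ν (-((β : ℂ) * u)))))
    (fun q u => Real.exp (-(p * u)) * (u ^ ν.re *
        (e (δ * (α * u)) q.1 * e (δ * (β * u)) q.2)))
    (fun q => ?_) (fun q => ?_) ?_ ?_ ?_
  · have h2 : ∀ q : ℕ × ℕ, ∫ u in Ioi (0 : ℝ), Complex.exp (-((p : ℂ) * u)) * ((u : ℂ) ^ ν *
        (t (-((α : ℂ) * u)) q.1 * t (-((β : ℂ) * u)) q.2)) =
        (1 / (p : ℂ)) ^ (ν + 1) * ((-(α / p : ℂ)) ^ q.1 * (-(β / p : ℂ)) ^ q.2 *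
          (Complex.Gamma ((q.1 : ℂ) + q.2 + ν + 1) /
            ((q.1.factorial * Complex.Gamma (q.1 + ν + 1)) *
              (q.2.factorial * Complex.Gamma (q.2 + ν + 1))))) := by
      rintro ⟨m, n⟩
      have hre : 0 < ((m : ℂ) + n + ν + 1).re := by
        have h1 : (0 : ℝ) ≤ m := Nat.cast_nonneg m
        have h2 : (0 : ℝ) ≤ n := Nat.cast_nonneg n
        simp only [Complex.add_re, Complex.natCast_re, Complex.one_re]
        linarith
      have hI := Complex.integral_cpow_mul_exp_neg_mul_Ioi hre hp
      have hc : (1 / (p : ℂ)) ^ ((m : ℂ) + n + ν + 1) =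
          (1 / (p : ℂ)) ^ (ν + 1) * ((1 / (p : ℂ)) ^ m * (1 / (p : ℂ)) ^ n) := by
        rw [show (m : ℂ) + n + ν + 1 = (ν + 1) + ((m + n : ℕ) : ℂ) by push_cast; ring,
          Complex.cpow_add _ _ (one_div_ne_zero hp'), Complex.cpow_natCast, pow_add]
      calc _ = ∫ u in Ioi (0 : ℝ), ((-(α : ℂ)) ^ m * (-(β : ℂ)) ^ n /
              ((m.factorial * Complex.Gamma (m + ν + 1)) *
              (n.factorial * Complex.Gamma (n + ν + 1)))) *
              ((u : ℂ) ^ ((m : ℂ) + n + ν + 1 - 1) * Complex.exp (-((p : ℂ) * u))) := by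
            refine setIntegral_congr_fun measurableSet_Ioi fun u hu => ?_
            have hu' : (u : ℂ) ≠ 0 := by exact_mod_cast (ne_of_gt hu : u ≠ 0)
            have hpow : (u : ℂ) ^ ((m : ℂ) + n + ν + 1 - 1) = (u : ℂ) ^ ν * (u ^ m * u ^ n) := by
              rw [show (m : ℂ) + n + ν + 1 - 1 = ν + ((m + n : ℕ) : ℂ) by push_cast; ring,
                Complex.cpow_add _ _ hu', Complex.cpow_natCast, pow_add]
            simp only [t]
            rw [hpow, ← neg_mul (α : ℂ), ← neg_mul (β : ℂ), mul_pow, mul_pow]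
            simp only [div_eq_mul_inv, mul_inv]
            ring
        _ = _ := by
            rw [integral_const_mul, hI, hc]
            simp only [neg_pow (α / p : ℂ), neg_pow (β / p : ℂ), neg_pow (α : ℂ),
              neg_pow (β : ℂ), div_pow, one_pow]
            simp only [div_eq_mul_inv, mul_inv]
            ring
    simp only [h2] at key
    exact key.unique ((hasSum_exp_mul_besselEntire hν _ _).mul_left _)
  · refine ContinuousOn.aestronglyMeasurable ?_ measurableSet_Ioi
    refine ContinuousOn.mul (Continuous.continuousOn (by fun_prop))
      ((continuousOn_ofReal_cpow ν).mul (Continuous.continuousOn ?_))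
    simp only [t]
    fun_prop
  · refine (ae_restrict_iff' measurableSet_Ioi).2 (ae_of_all _ fun u hu => ?_)
    have hu' : 0 < u := hu
    rw [norm_mul, norm_exp_neg_mul_ofReal, Complex.ofReal_re, norm_mul,
      Complex.norm_cpow_eq_rpow_re_of_pos hu, norm_mul]
    have h1 := norm_besselEntire_term_le hG (-((α : ℂ) * u)) q.1
    have h2 := norm_besselEntire_term_le hG (-((β : ℂ) * u)) q.2
    rw [hn _ hα _ hu'] at h1
    rw [hn _ hβ _ hu'] at h2
    simp only [t, e]
    gcongr
  · refine (ae_restrict_iff' measurableSet_Ioi).2 (ae_of_all _ fun u hu => ?_)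
    exact (hee u hu).summable
  · refine IntegrableOn.congr_fun (f := fun u : ℝ => C * C * (u ^ ν.re *
      Real.exp (-((p - δ * (α + β)) * u)))) ?_ (fun u hu => ?_) measurableSet_Ioi
    · refine (integrableOn_rpow_mul_exp_neg hν ?_).const_mul _
      have : δ * (α + β) ≤ p / 2 := by
        simp only [δ]
        rw [div_mul_eq_mul_div, div_le_iff₀ (by positivity)]
        nlinarith
      linarith
    · simp only
      rw [(hee u hu).tsum_eq, show -((p - δ * (α + β)) * u) = -(p * u) + δ * (α * u) +
        δ * (β * u) by ring, Real.exp_add, Real.exp_add]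
      ring
  · refine (ae_restrict_iff' measurableSet_Ioi).2 (ae_of_all _ fun u hu => ?_)
    exact (((hasSum_besselEntire hν _).mul (hasSum_besselEntire hν _)
      ((summable_norm_besselEntire hν _).mul_norm
        (summable_norm_besselEntire hν _)).of_norm).mul_left _).mul_left _

lemma aestronglyMeasurable_besselProd {ν : ℂ} (hν : -1 < ν.re) {a b : ℝ} (ha : 0 < a)
    (hb : 0 < b) : AEStronglyMeasurable (besselProd ν a b) (volume.restrict (Ioi 0)) := by
  refine ((aestronglyMeasurable_entire_prod hν (a ^ 2 / 4) (b ^ 2 / 4)).const_mul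
    (((a * b / 4 : ℝ) : ℂ) ^ ν)).congr ?_
  refine (ae_restrict_iff' measurableSet_Ioi).2 (ae_of_all _ fun u hu => ?_)
  exact (besselProd_eq ν ha hb hu).symm

lemma integrableOn_exp_mul_besselProd_ofReal {ν : ℂ} (hν : -1 < ν.re) {a b : ℝ} (ha : 0 < a)
    (hb : 0 < b) {p : ℝ} (hp : 0 < p) :
    IntegrableOn (fun u : ℝ => Complex.exp (-((p : ℂ) * u)) * besselProd ν a b u) (Ioi 0) := by
  have h := (integrableOn_exp_mul_entire_prod hν (α := a ^ 2 / 4) (β := b ^ 2 / 4)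
    (by positivity) (by positivity) hp).const_mul (((a * b / 4 : ℝ) : ℂ) ^ ν)
  refine IntegrableOn.congr_fun h (fun u hu => ?_) measurableSet_Ioi
  rw [besselProd_eq ν ha hb hu]
  ring

lemma integrableOn_exp_mul_besselProd {ν : ℂ} (hν : -1 < ν.re) {a b : ℝ} (ha : 0 < a)
    (hb : 0 < b) {p : ℂ} (hp : 0 < p.re) :
    IntegrableOn (fun u : ℝ => Complex.exp (-(p * u)) * besselProd ν a b u) (Ioi 0) :=
  integrableOn_laplace (fun _ hε => integrableOn_exp_mul_besselProd_ofReal hν ha hb hε)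
    (aestronglyMeasurable_besselProd hν ha hb) hp

lemma integral_exp_mul_besselProd_ofReal {ν : ℂ} (hν : -1 < ν.re) {a b : ℝ} (ha : 0 < a)
    (hb : 0 < b) {p : ℝ} (hp : 0 < p) :
    ∫ u in Ioi (0 : ℝ), Complex.exp (-((p : ℂ) * u)) * besselProd ν a b u =
      1 / (p : ℂ) * weberKernel ν a b (1 / (p : ℂ)) := by
  have hp' : (p : ℂ) ≠ 0 := by exact_mod_cast hp.ne'
  have hre : 0 ≤ (1 / (p : ℂ)).re := by
    rw [one_div, ← Complex.ofReal_inv, Complex.ofReal_re]; positivity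
  calc _ = ∫ u in Ioi (0 : ℝ), ((a * b / 4 : ℝ) : ℂ) ^ ν * (Complex.exp (-((p : ℂ) * u)) *
        ((u : ℂ) ^ ν * (besselEntire ν (-((a ^ 2 / 4 : ℝ) * (u : ℂ))) *
          besselEntire ν (-((b ^ 2 / 4 : ℝ) * (u : ℂ)))))) := by
        refine setIntegral_congr_fun measurableSet_Ioi fun u hu => ?_
        rw [besselProd_eq ν ha hb hu]
        ring
    _ = _ := by
        rw [integral_const_mul, integral_exp_mul_entire_prod hν (by positivity) (by positivity) hp,
          weberKernel_eq ν ha hb (one_div_ne_zero hp') hre,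
          Complex.cpow_add _ _ (one_div_ne_zero hp'), Complex.cpow_one, ← Complex.exp_add]
        have e1 : -(((a ^ 2 / 4 : ℝ) : ℂ) / p) + -(((b ^ 2 / 4 : ℝ) : ℂ) / p) =
            -(1 / (p : ℂ) * (((a : ℂ) ^ 2 + (b : ℂ) ^ 2) / 4)) := by
          push_cast; ring
        have e2 : ((a ^ 2 / 4 : ℝ) : ℂ) / p * (((b ^ 2 / 4 : ℝ) : ℂ) / p) =
            (1 / (p : ℂ) * ((a * b / 2 : ℝ) : ℂ)) ^ 2 / 4 := by
          push_cast; ring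
        rw [e1, e2]
        ring

lemma differentiableOn_weberKernel {ν : ℂ} (hν : -1 < ν.re) {a b : ℝ} (ha : 0 < a)
    (hb : 0 < b) : DifferentiableOn ℂ (weberKernel ν a b) {ζ : ℂ | 0 < ζ.re} := by
  have hF := differentiable_besselEntire hν
  refine DifferentiableOn.congr (f := fun ζ : ℂ => ((a * b / 4 : ℝ) : ℂ) ^ ν * (ζ ^ ν *
      (besselEntire ν ((ζ * (a * b / 2 : ℝ)) ^ 2 / 4) *
        Complex.exp (-(ζ * (((a : ℂ) ^ 2 + (b : ℂ) ^ 2) / 4)))))) ?_ fun ζ hζ => ?_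
  · refine (DifferentiableOn.mul (fun ζ hζ => ?_)
      (Differentiable.differentiableOn (by fun_prop))).const_mul _
    exact (DifferentiableAt.cpow_const differentiableAt_id (Or.inl hζ)).differentiableWithinAt
  · have hζ' : 0 < ζ.re := hζ
    exact weberKernel_eq ν ha hb (fun h => by simp [h] at hζ') hζ'.le

/-- The punctured closed half-plane avoids the cut of `ζ^ν`. Its imaginary axis corresponds to the
boundary rays `h |arg p| = π/2`. -/
lemma continuousOn_weberKernel {ν : ℂ} (hν : -1 < ν.re) {a b : ℝ} (ha : 0 < a)
    (hb : 0 < b) : ContinuousOn (weberKernel ν a b) {ζ : ℂ | 0 ≤ ζ.re ∧ ζ ≠ 0} := by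
  have hF := continuous_besselEntire hν
  refine ContinuousOn.congr (f := fun ζ : ℂ => ((a * b / 4 : ℝ) : ℂ) ^ ν * (ζ ^ ν *
      (besselEntire ν ((ζ * (a * b / 2 : ℝ)) ^ 2 / 4) *
        Complex.exp (-(ζ * (((a : ℂ) ^ 2 + (b : ℂ) ^ 2) / 4)))))) ?_ fun ζ hζ =>
          weberKernel_eq ν ha hb hζ.2 hζ.1
  refine continuousOn_const.mul (ContinuousOn.mul (fun ζ hζ => ?_)
    (Continuous.continuousOn (by fun_prop)))
  refine (continuousAt_cpow_const ?_).continuousWithinAt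
  rw [Complex.mem_slitPlane_iff_arg]
  have h := Complex.abs_arg_le_pi_div_two_iff.2 hζ.1
  refine ⟨fun h0 => ?_, hζ.2⟩
  rw [h0, abs_of_pos Real.pi_pos] at h
  linarith [Real.pi_pos]

lemma one_div_re_pos {p : ℂ} (hp : 0 < p.re) : 0 < (1 / p).re := by
  have : p ≠ 0 := fun h => by simp [h] at hp
  rw [one_div, Complex.inv_re]
  exact div_pos hp (Complex.normSq_pos.2 this)

/-- Weber's second exponential integral, as a Laplace transform. -/
lemma integral_exp_mul_besselProd {ν : ℂ} (hν : -1 < ν.re) {a b : ℝ} (ha : 0 < a)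
    (hb : 0 < b) {p : ℂ} (hp : 0 < p.re) :
    ∫ u in Ioi (0 : ℝ), Complex.exp (-(p * u)) * besselProd ν a b u =
      1 / p * weberKernel ν a b (1 / p) := by
  refine eqOn_re_pos_of_eq_real (f := fun p : ℂ => ∫ u in Ioi (0 : ℝ),
    Complex.exp (-(p * u)) * besselProd ν a b u)
    (g := fun p : ℂ => 1 / p * weberKernel ν a b (1 / p)) ?_ ?_
    (fun p hp => integral_exp_mul_besselProd_ofReal hν ha hb hp) hp
  · exact differentiableOn_laplace
      (fun _ hε => integrableOn_exp_mul_besselProd_ofReal hν ha hb hε)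
      (aestronglyMeasurable_besselProd hν ha hb)
  · have hd : DifferentiableOn ℂ (fun p : ℂ => 1 / p) {p : ℂ | 0 < p.re} := fun z hz => by
      have hz' : 0 < z.re := hz
      have : z ≠ 0 := fun h => by simp [h] at hz'
      exact ((differentiableAt_const _).div differentiableAt_id this).differentiableWithinAt
    exact hd.mul ((differentiableOn_weberKernel hν ha hb).comp hd fun z hz => one_div_re_pos hz)

/-- Weber's formula at `p = 1/ζ`, rescaled by `u = ζy`. In this direction it trades the kernel for
one more exponential variable `y`. -/
lemma weberKernel_eq_integral {ν : ℂ} (hν : -1 < ν.re) {a b : ℝ} (ha : 0 < a)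
    (hb : 0 < b) {ζ : ℝ} (hζ : 0 < ζ) :
    ∫ y in Ioi (0 : ℝ), besselProd ν a b (ζ * y) * Complex.exp (-(y : ℂ)) =
      weberKernel ν a b ζ := by
  have hζ' : (ζ : ℂ) ≠ 0 := by exact_mod_cast hζ.ne'
  have h := integral_exp_mul_besselProd_ofReal hν ha hb (inv_pos.2 hζ)
  have h2 := integral_comp_mul_left_Ioi (fun u : ℝ => Complex.exp (-(((ζ⁻¹ : ℝ) : ℂ) * u)) *
    besselProd ν a b u) 0 hζ
  rw [mul_zero, h] at h2
  rw [← show ((1 : ℂ) / ((ζ⁻¹ : ℝ) : ℂ)) = ζ by push_cast; simp]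
  rw [Complex.real_smul, ← mul_assoc, mul_one_div_cancel (by simpa using hζ'), one_mul] at h2
  rw [← h2]
  refine setIntegral_congr_fun measurableSet_Ioi fun y _ => ?_
  rw [mul_comm]
  congr 3
  push_cast
  field_simp

/-! ### Poisson's integral and growth bounds. -/

lemma norm_cosh_le (w : ℂ) : ‖Complex.cosh w‖ ≤ Real.exp |w.re| := by
  rw [Complex.cosh, norm_div, Complex.norm_ofNat]
  have h1 : ‖Complex.exp w‖ ≤ Real.exp |w.re| := by
    rw [Complex.norm_exp]; exact Real.exp_le_exp.2 (le_abs_self _)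
  have h2 : ‖Complex.exp (-w)‖ ≤ Real.exp |w.re| := by
    rw [Complex.norm_exp, Complex.neg_re]; exact Real.exp_le_exp.2 (neg_le_abs _)
  have := norm_add_le (Complex.exp w) (Complex.exp (-w))
  linarith

/-- Legendre duplication turns `4^m m!` into `√π (2m)! / Γ(m + 1/2)`, and the remaining Gamma
quotient is a Beta integral. The `(2m)!` is what makes the sum a hyperbolic cosine. -/
lemma besselEntire_term_eq_betaIntegral {ν : ℂ} (hν : -(1 / 2) < ν.re) (z : ℂ) (m : ℕ) :
    (z ^ 2 / 4) ^ m / ((m.factorial : ℂ) * Complex.Gamma ((m : ℂ) + ν + 1)) =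
      ((√Real.pi : ℝ) * Complex.Gamma (ν + 1 / 2))⁻¹ *
        (z ^ (2 * m) / (2 * m).factorial * Complex.betaIntegral (m + 1 / 2) (ν + 1 / 2)) := by
  have hm : (0 : ℝ) ≤ m := Nat.cast_nonneg m
  have hre1 : 0 < ((m : ℂ) + 1 / 2).re := by
    simp only [Complex.add_re, Complex.natCast_re, Complex.div_ofNat_re, Complex.one_re]
    linarith
  have hre2 : 0 < (ν + 1 / 2).re := by
    simp only [Complex.add_re, Complex.div_ofNat_re, Complex.one_re]
    linarith
  have hB := Complex.Gamma_mul_Gamma_eq_betaIntegral hre1 hre2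
  have hD := Complex.Gamma_mul_Gamma_add_half ((m : ℂ) + 1 / 2)
  have e1 : (m : ℂ) + 1 / 2 + 1 / 2 = m + 1 := by ring
  have e2 : 2 * ((m : ℂ) + 1 / 2) = ((2 * m : ℕ) : ℂ) + 1 := by push_cast; ring
  have e3 : (1 : ℂ) - (((2 * m : ℕ) : ℂ) + 1) = -((2 * m : ℕ) : ℂ) := by ring
  have e4 : (m : ℂ) + 1 / 2 + (ν + 1 / 2) = m + ν + 1 := by ring
  rw [e1, e2, e3, Complex.Gamma_nat_eq_factorial, Complex.Gamma_nat_eq_factorial,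
    Complex.cpow_neg, Complex.cpow_natCast] at hD
  rw [e4] at hB
  have g1 := Gamma_nat_add_ne_zero (ν := ν) (by linarith) m
  have g2 := Complex.Gamma_ne_zero_of_re_pos hre2
  have f1 : (m.factorial : ℂ) ≠ 0 := by exact_mod_cast m.factorial_ne_zero
  have f2 : ((2 * m).factorial : ℂ) ≠ 0 := by exact_mod_cast (2 * m).factorial_ne_zero
  have hpi : ((√Real.pi : ℝ) : ℂ) ≠ 0 := by
    exact_mod_cast (Real.sqrt_pos.2 Real.pi_pos).ne'
  have hb : Complex.betaIntegral (m + 1 / 2) (ν + 1 / 2) =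
      Complex.Gamma (m + 1 / 2) * Complex.Gamma (ν + 1 / 2) / Complex.Gamma (m + ν + 1) := by
    rw [hB]; field_simp
  have hg : Complex.Gamma (m + 1 / 2) =
      (2 * m).factorial * (2 ^ (2 * m))⁻¹ * (√Real.pi : ℝ) / m.factorial := by
    rw [← hD]; field_simp
  rw [hb, hg, div_pow, ← pow_mul, pow_mul 2 2 m]
  generalize Complex.Gamma (ν + 1 / 2) = g at g2 ⊢
  norm_num
  field_simp

/-- Summing the Beta integrals gives Poisson's representation: `F(z²/4)` is a constant times `∫₀¹
cosh(z√x) x^{-1/2} (1 - x)^{ν - 1/2} dx`. The weight is integrable exactly because `Re ν > -1/2`,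
and `|cosh(z√x)| ≤ e^{|Re z|}`. -/
lemma exists_norm_besselEntire_sq_le {ν : ℂ} (hν : -(1 / 2) < ν.re) :
    ∃ C : ℝ, 0 < C ∧ ∀ z : ℂ, ‖besselEntire ν (z ^ 2 / 4)‖ ≤ C * Real.exp |z.re| := by
  have hre : 0 < (ν + 1 / 2).re := by
    simp only [Complex.add_re, Complex.div_ofNat_re, Complex.one_re]
    linarith
  let W : ℝ → ℂ := fun x => (x : ℂ) ^ ((1 / 2 : ℂ) - 1) * (1 - (x : ℂ)) ^ (ν + 1 / 2 - 1)
  have hW : Integrable W (volume.restrict (Ioc (0 : ℝ) 1)) := by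
    have := Complex.betaIntegral_convergent (u := 1 / 2) (v := ν + 1 / 2) (by norm_num) hre
    rwa [intervalIntegrable_iff_integrableOn_Ioc_of_le zero_le_one] at this
  let K : ℂ := ((√Real.pi : ℝ) * Complex.Gamma (ν + 1 / 2))⁻¹
  have hrep : ∀ z : ℂ, besselEntire ν (z ^ 2 / 4) =
      K * ∫ x in Ioc (0 : ℝ) 1, Complex.cosh (z * (√x : ℝ)) * W x := by
    intro z
    have key := hasSum_integral_of_dominated_convergence (μ := volume.restrict (Ioc (0 : ℝ) 1))
      (F := fun (m : ℕ) (x : ℝ) => (z * (√x : ℝ)) ^ (2 * m) / (2 * m).factorial * W x)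
      (f := fun x : ℝ => Complex.cosh (z * (√x : ℝ)) * W x)
      (fun m x => ‖z‖ ^ (2 * m) / (2 * m).factorial * ‖W x‖)
      (fun m => ?_) (fun m => ?_) ?_ ?_ ?_
    · have hi : ∀ m : ℕ, ∫ x in Ioc (0 : ℝ) 1,
          (z * (√x : ℝ)) ^ (2 * m) / (2 * m).factorial * W x =
          z ^ (2 * m) / (2 * m).factorial * Complex.betaIntegral (m + 1 / 2) (ν + 1 / 2) := by
        intro m
        rw [Complex.betaIntegral, intervalIntegral.integral_of_le zero_le_one,
          ← integral_const_mul]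
        refine setIntegral_congr_fun measurableSet_Ioc fun x hx => ?_
        have hx0 : (x : ℂ) ≠ 0 := by exact_mod_cast hx.1.ne'
        have hsq : ((√x : ℝ) : ℂ) ^ 2 = x := by exact_mod_cast Real.sq_sqrt hx.1.le
        have hp : (x : ℂ) ^ ((m : ℂ) + 1 / 2 - 1) = (x : ℂ) ^ m * (x : ℂ) ^ ((1 / 2 : ℂ) - 1) := by
          rw [show (m : ℂ) + 1 / 2 - 1 = m + (1 / 2 - 1) by ring, Complex.cpow_add _ _ hx0,
            Complex.cpow_natCast]
        simp only [W]
        rw [hp, mul_pow, pow_mul ((√x : ℝ) : ℂ), hsq]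
        ring
      simp only [hi] at key
      have h2 := key.mul_left K
      refine HasSum.unique (hasSum_besselEntire (by linarith) _) (h2.congr_fun fun m => ?_)
      exact besselEntire_term_eq_betaIntegral hν z m
    · refine AEStronglyMeasurable.mul (Continuous.aestronglyMeasurable ?_) hW.1
      fun_prop
    · refine (ae_restrict_iff' measurableSet_Ioc).2 (ae_of_all _ fun x hx => ?_)
      rw [norm_mul, norm_div, norm_pow, norm_mul, Complex.norm_natCast, Complex.norm_real,
        Real.norm_of_nonneg (Real.sqrt_nonneg x)]
      gcongr
      exact mul_le_of_le_one_right (norm_nonneg z) (Real.sqrt_le_one.2 hx.2)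
    · exact ae_of_all _ fun x => (Real.hasSum_cosh ‖z‖).summable.mul_right _
    · simp only [tsum_mul_right]
      exact hW.norm.const_mul _
    · exact ae_of_all _ fun x => (Complex.hasSum_cosh _).mul_right _
  refine ⟨‖K‖ * (∫ x in Ioc (0 : ℝ) 1, ‖W x‖) + 1, by positivity, fun z => ?_⟩
  rw [hrep z, norm_mul]
  have hle : ‖∫ x in Ioc (0 : ℝ) 1, Complex.cosh (z * (√x : ℝ)) * W x‖ ≤
      ∫ x in Ioc (0 : ℝ) 1, Real.exp |z.re| * ‖W x‖ := by
    refine norm_integral_le_of_norm_le (hW.norm.const_mul _) ?_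
    refine (ae_restrict_iff' measurableSet_Ioc).2 (ae_of_all _ fun x hx => ?_)
    rw [norm_mul]
    gcongr
    refine (norm_cosh_le _).trans (Real.exp_le_exp.2 ?_)
    rw [Complex.re_mul_ofReal, abs_mul, abs_of_nonneg (Real.sqrt_nonneg x)]
    exact mul_le_of_le_one_right (abs_nonneg _) (Real.sqrt_le_one.2 hx.2)
  rw [integral_const_mul] at hle
  calc _ ≤ ‖K‖ * (Real.exp |z.re| * ∫ x in Ioc (0 : ℝ) 1, ‖W x‖) := by gcongr
    _ ≤ _ := by nlinarith [Real.exp_pos |z.re|]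

lemma exists_norm_besselProd_le {ν : ℂ} (hν : -(1 / 2) < ν.re) {a b : ℝ} (ha : 0 < a)
    (hb : 0 < b) : ∃ C : ℝ, 0 < C ∧ ∀ s : ℝ, 0 < s → ‖besselProd ν a b s‖ ≤ C * s ^ ν.re := by
  obtain ⟨C, hC, h⟩ := exists_norm_besselEntire_sq_le hν
  have hF : ∀ c s : ℝ, 0 < s → ‖besselEntire ν (-((c ^ 2 / 4 : ℝ) * (s : ℂ)))‖ ≤ C := by
    intro c s hs
    have hsq : ((√s : ℝ) : ℂ) ^ 2 = s := by exact_mod_cast Real.sq_sqrt hs.le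
    -- On the imaginary axis the exponential bound is constant, which is the boundedness needed for
    -- `J_ν`.
    have := h (Complex.I * (c * √s : ℝ))
    rw [Complex.re_mul_ofReal, Complex.I_re, zero_mul, abs_zero, Real.exp_zero, mul_one] at this
    convert this using 3
    rw [mul_pow, Complex.I_sq]
    push_cast
    rw [mul_pow, hsq]
    ring
  refine ⟨‖((a * b / 4 : ℝ) : ℂ) ^ ν‖ * (C * C) + 1, by positivity, fun s hs => ?_⟩
  rw [besselProd_eq ν ha hb hs, norm_mul, norm_mul, norm_mul,
    Complex.norm_cpow_eq_rpow_re_of_pos hs]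
  have hp := Real.rpow_nonneg hs.le ν.re
  calc _ ≤ ‖((a * b / 4 : ℝ) : ℂ) ^ ν‖ * (s ^ ν.re * (C * C)) := by
        gcongr
        · exact hF a s hs
        · exact hF b s hs
    _ ≤ _ := by nlinarith

/-- The growth `e^{Re ζ · ab/2}` of the Bessel factor is absorbed by `e^{-Re ζ (a² + b²)/4}`,
leaving `e^{-Re ζ (a - b)²/4} ≤ 1`. The argument of `ζ` costs at most `e^{π |Im ν|}`. -/
lemma exists_norm_weberKernel_le {ν : ℂ} (hν : -(1 / 2) < ν.re) {a b : ℝ} (ha : 0 < a)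
    (hb : 0 < b) : ∃ C : ℝ, 0 < C ∧ ∀ ζ : ℂ, 0 ≤ ζ.re → ζ ≠ 0 →
      ‖weberKernel ν a b ζ‖ ≤ C * ‖ζ‖ ^ ν.re := by
  obtain ⟨C, hC, h⟩ := exists_norm_besselEntire_sq_le hν
  refine ⟨‖((a * b / 4 : ℝ) : ℂ) ^ ν‖ * (Real.exp (Real.pi * |ν.im|) * C) + 1, by positivity,
    fun ζ hre hζ => ?_⟩
  have h1 : ‖ζ ^ ν‖ ≤ ‖ζ‖ ^ ν.re * Real.exp (Real.pi * |ν.im|) := by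
    rw [Complex.norm_cpow_of_ne_zero hζ, div_eq_mul_inv, ← Real.exp_neg]
    gcongr
    refine (neg_le_abs _).trans ?_
    rw [abs_mul]
    gcongr
    exact Complex.abs_arg_le_pi ζ
  have h2 : ‖besselEntire ν ((ζ * (a * b / 2 : ℝ)) ^ 2 / 4) *
      Complex.exp (-(ζ * (((a : ℂ) ^ 2 + (b : ℂ) ^ 2) / 4)))‖ ≤ C := by
    rw [norm_mul, show ζ * (((a : ℂ) ^ 2 + (b : ℂ) ^ 2) / 4) =
      ζ * (((a ^ 2 + b ^ 2) / 4 : ℝ) : ℂ) by push_cast; ring, norm_exp_neg_mul_ofReal]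
    have := h (ζ * (a * b / 2 : ℝ))
    rw [Complex.re_mul_ofReal, abs_of_nonneg (by positivity)] at this
    calc _ ≤ C * Real.exp (ζ.re * (a * b / 2)) * Real.exp (-(ζ.re * ((a ^ 2 + b ^ 2) / 4))) := by
          gcongr
      _ = C * Real.exp (-(ζ.re * ((a - b) ^ 2 / 4))) := by
          rw [mul_assoc, ← Real.exp_add]
          ring_nf
      _ ≤ C := by
          refine mul_le_of_le_one_right hC.le (Real.exp_le_one_iff.2 ?_)
          have : 0 ≤ ζ.re * ((a - b) ^ 2 / 4) := by positivity
          linarith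
  rw [weberKernel_eq ν ha hb hζ hre, norm_mul, norm_mul (ζ ^ ν)]
  have hp := Real.rpow_nonneg (norm_nonneg ζ) ν.re
  calc _ ≤ ‖((a * b / 4 : ℝ) : ℂ) ^ ν‖ * (‖ζ‖ ^ ν.re * Real.exp (Real.pi * |ν.im|) * C) := by
        gcongr
    _ ≤ _ := by nlinarith

/-! ### Gauss's multiplication formula. -/

lemma convexOn_log_Gamma_affine {c d : ℝ} (hc : 0 < c) (hd : 0 ≤ d) :
    ConvexOn ℝ (Ioi 0) (fun x => Real.log (Real.Gamma ((x + d) / c))) := by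
  refine ⟨convex_Ioi 0, fun x hx y hy s t hs ht hst => ?_⟩
  have hx' : 0 < x := hx
  have hy' : 0 < y := hy
  have h := Real.convexOn_log_Gamma.2 (show (x + d) / c ∈ Ioi 0 by simp only [mem_Ioi]; positivity)
    (show (y + d) / c ∈ Ioi 0 by simp only [mem_Ioi]; positivity) hs ht hst
  simp only [Function.comp_apply, smul_eq_mul] at h ⊢
  refine le_trans (le_of_eq ?_) h
  congr 2
  have : d = (s + t) * d := by rw [hst, one_mul]
  field_simp
  linear_combination this

/-- Gauss's multiplication formula, up to the value of the constant. -/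
lemma prod_Gamma_add_div {h : ℕ} (hh : 1 ≤ h) {x : ℝ} (hx : 0 < x) :
    ∏ k ∈ Finset.range h, Real.Gamma ((x + k) / h) =
      (∏ k ∈ Finset.range h, Real.Gamma ((1 + k) / h)) * (h : ℝ) ^ (1 - x) * Real.Gamma x := by
  have hh' : (0 : ℝ) < h := by exact_mod_cast hh
  have hpos : ∀ y : ℝ, 0 < y → ∀ k : ℕ, 0 < Real.Gamma ((y + k) / h) := fun y hy k =>
    Real.Gamma_pos_of_pos (by positivity)
  let K : ℝ := ∏ k ∈ Finset.range h, Real.Gamma ((1 + k) / h)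
  have hK : 0 < K := Finset.prod_pos fun k _ => hpos 1 one_pos k
  let f : ℝ → ℝ := fun y => (h : ℝ) ^ (y - 1) * (∏ k ∈ Finset.range h, Real.Gamma ((y + k) / h)) / K
  have hP : ∀ y : ℝ, 0 < y → 0 < ∏ k ∈ Finset.range h, Real.Gamma ((y + k) / h) := fun y hy =>
    Finset.prod_pos fun k _ => hpos y hy k
  -- Bohr–Mollerup: `f` is log-convex, satisfies `f(y + 1) = y f(y)`, is positive, and equals `1` at
  -- `1` by the choice of `K`.
  have hf : EqOn f Real.Gamma (Ioi 0) := by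
    refine Real.eq_Gamma_of_log_convex ?_ ?_ ?_ ?_
    · have hc : ConvexOn ℝ (Ioi 0) (fun y : ℝ => Real.log h * y +
          ∑ k ∈ Finset.range h, Real.log (Real.Gamma ((y + k) / h)) +
            (-Real.log h - Real.log K)) := by
        refine (ConvexOn.add ?_ ?_).add_const _
        · exact ((LinearMap.mul ℝ ℝ (Real.log h)).convexOn (convex_Ioi 0))
        · have : ∀ s : Finset ℕ, ConvexOn ℝ (Ioi 0) (fun y : ℝ =>
              ∑ k ∈ s, Real.log (Real.Gamma ((y + k) / h))) := by
            intro s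
            induction s using Finset.induction_on with
            | empty => simpa using convexOn_const (0 : ℝ) (convex_Ioi (0 : ℝ))
            | insert k s hk ih =>
              simp only [Finset.sum_insert hk]
              exact (convexOn_log_Gamma_affine hh' (Nat.cast_nonneg k)).add ih
          exact this _
      refine hc.congr fun y hy => ?_
      have hy' : 0 < y := hy
      simp only [Function.comp_apply, f]
      rw [Real.log_div (mul_pos (Real.rpow_pos_of_pos hh' _) (hP y hy)).ne' hK.ne',
        Real.log_mul (Real.rpow_pos_of_pos hh' _).ne' (hP y hy).ne', Real.log_rpow hh',
        Real.log_prod (fun k _ => (hpos y hy k).ne')]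
      ring
    · intro y hy
      -- Raising `y` by one shifts the index, so only the end factors differ: `Γ(y/h)` is replaced
      -- by `Γ(y/h + 1)`.
      have e : ∏ k ∈ Finset.range h, Real.Gamma ((y + 1 + k) / h) =
          (∏ k ∈ Finset.range h, Real.Gamma ((y + k) / h)) * (y / h) := by
        obtain ⟨n, rfl⟩ : ∃ n, h = n + 1 := ⟨h - 1, by omega⟩
        rw [Finset.prod_range_succ, Finset.prod_range_succ' (fun k : ℕ =>
          Real.Gamma ((y + k) / ((n + 1 : ℕ) : ℝ))), mul_assoc]
        congr 1
        · refine Finset.prod_congr rfl fun k _ => ?_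
          congr 2
          push_cast
          ring
        · have hy0 : y / ((n + 1 : ℕ) : ℝ) ≠ 0 := (div_pos hy hh').ne'
          rw [Nat.cast_zero, add_zero, mul_comm, ← Real.Gamma_add_one hy0]
          congr 1
          field_simp
          push_cast
          ring
      simp only [f]
      rw [e, add_sub_cancel_right, Real.rpow_sub_one hh'.ne']
      field_simp
    · intro y hy
      exact div_pos (mul_pos (Real.rpow_pos_of_pos hh' _) (hP y hy)) hK
    · simp only [f, sub_self, Real.rpow_zero, one_mul]
      exact div_self hK.ne'
  rw [← hf hx]
  simp only [f]
  change _ = K * _ * _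
  rw [show 1 - x = -(x - 1) by ring, Real.rpow_neg hh'.le]
  have : (h : ℝ) ^ (x - 1) ≠ 0 := (Real.rpow_pos_of_pos hh' _).ne'
  field_simp

/-- For a primitive `(n + 1)`-st root of unity `ζ` the product of the `1 - ζ^{k+1}` is `n + 1`, and
`|1 - e^{2iθ}| = 2 sin θ` on `[0, π]`. -/
lemma prod_sin_pi_mul_div (n : ℕ) :
    ∏ k ∈ Finset.range n, (2 * Real.sin (Real.pi * ((1 + k) / (n + 1 : ℝ)))) = n + 1 := by
  have hprim := Complex.isPrimitiveRoot_exp (n + 1) n.succ_ne_zero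
  have h := congrArg norm hprim.prod_one_sub_pow_eq_order
  rw [norm_prod] at h
  have hr : ‖(n : ℂ) + 1‖ = n + 1 := by
    have := Complex.norm_natCast (n + 1)
    push_cast at this
    exact this
  rw [hr] at h
  refine Eq.trans ?_ h
  refine Finset.prod_congr rfl fun k hk => ?_
  have hk' : (k : ℝ) + 1 ≤ n := by exact_mod_cast Finset.mem_range.1 hk
  have hn : (0 : ℝ) < n + 1 := by positivity
  rw [norm_sub_rev, ← Complex.exp_nat_mul]
  have e : ((k + 1 : ℕ) : ℂ) * (2 * Real.pi * Complex.I / ((n + 1 : ℕ) : ℂ)) =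
      Complex.I * ((2 * (Real.pi * ((1 + k) / (n + 1 : ℝ))) : ℝ) : ℂ) := by
    push_cast
    ring
  rw [e, Complex.norm_exp_I_mul_ofReal_sub_one, mul_div_cancel_left₀ _ two_ne_zero,
    Real.norm_of_nonneg]
  refine mul_nonneg zero_le_two (Real.sin_nonneg_of_nonneg_of_le_pi (by positivity) ?_)
  refine mul_le_of_le_one_right Real.pi_pos.le ?_
  rw [div_le_one hn]
  linarith

/-- The constant in Gauss's multiplication formula. -/
lemma prod_Gamma_div (n : ℕ) :
    ∏ k ∈ Finset.range n, Real.Gamma ((1 + k) / (n + 1 : ℝ)) =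
      (2 * Real.pi) ^ ((n : ℝ) / 2) * (n + 1 : ℝ) ^ (-(1 / 2) : ℝ) := by
  have hn : (0 : ℝ) < n + 1 := by positivity
  have hL : 0 < ∏ k ∈ Finset.range n, Real.Gamma ((1 + k) / (n + 1 : ℝ)) :=
    Finset.prod_pos fun k _ => Real.Gamma_pos_of_pos (by positivity)
  have hR : 0 < (2 * Real.pi) ^ ((n : ℝ) / 2) * (n + 1 : ℝ) ^ (-(1 / 2) : ℝ) := by
    have := Real.pi_pos
    positivity
  rw [← sq_eq_sq₀ hL.le hR.le]
  have hsin : ∀ k ∈ Finset.range n, 0 < Real.sin (Real.pi * ((1 + k) / (n + 1 : ℝ))) := by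
    intro k hk
    have hk' : (k : ℝ) + 1 ≤ n := by exact_mod_cast Finset.mem_range.1 hk
    have := Real.pi_pos
    refine Real.sin_pos_of_pos_of_lt_pi (by positivity) ?_
    refine mul_lt_of_lt_one_right Real.pi_pos ?_
    rw [div_lt_one hn]
    linarith
  -- Reversing the product pairs each factor of the square with its reflection, so `Γ(x) Γ(1 - x) =
  -- π / sin πx` reduces the square to the sine product.
  have hrefl : ∏ k ∈ Finset.range n, Real.Gamma ((1 + k) / (n + 1 : ℝ)) =
      ∏ k ∈ Finset.range n, Real.Gamma (1 - (1 + k) / (n + 1 : ℝ)) := by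
    rw [← Finset.prod_range_reflect]
    refine Finset.prod_congr rfl fun k hk => ?_
    have hk' : k + 1 ≤ n := Finset.mem_range.1 hk
    rw [Nat.sub_sub, Nat.cast_sub (by omega)]
    congr 1
    field_simp
    push_cast
    ring
  have hsq : (∏ k ∈ Finset.range n, Real.Gamma ((1 + k) / (n + 1 : ℝ))) ^ 2 *
      ∏ k ∈ Finset.range n, (2 * Real.sin (Real.pi * ((1 + k) / (n + 1 : ℝ)))) =
      (2 * Real.pi) ^ n := by
    rw [sq]
    nth_rw 2 [hrefl]
    rw [← Finset.prod_mul_distrib, ← Finset.prod_mul_distrib]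
    rw [Finset.prod_congr rfl (g := fun _ => 2 * Real.pi), Finset.prod_const, Finset.card_range]
    intro k hk
    have := (hsin k hk).ne'
    rw [Real.Gamma_mul_Gamma_one_sub]
    generalize Real.sin (Real.pi * ((1 + k) / (n + 1 : ℝ))) = t at this ⊢
    field_simp
  rw [prod_sin_pi_mul_div] at hsq
  rw [mul_pow, ← Real.rpow_natCast ((2 * Real.pi) ^ _), ← Real.rpow_natCast ((n + 1 : ℝ) ^ _),
    ← Real.rpow_mul (by positivity), ← Real.rpow_mul hn.le]
  norm_num
  rw [Real.rpow_neg_one, ← hsq]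
  field_simp

/-! ### Moments of the Gamma weights on the orthant. -/

lemma integrableOn_rpow_mul_exp_neg_iff {s : ℝ} :
    IntegrableOn (fun x : ℝ => x ^ (s - 1) * Real.exp (-x)) (Ioi 0) ↔ 0 < s := by
  refine ⟨fun h => ?_, fun h => ?_⟩
  -- On `(0, 1)` one has `e · e^{-x} ≥ 1`, so integrability near `0` is that of the bare power.
  · have h1 : IntegrableOn (fun x : ℝ => x ^ (s - 1)) (Ioo 0 1) := by
      refine Integrable.mono' ((h.mono_set Ioo_subset_Ioi_self).const_mul (Real.exp 1))
        (ContinuousOn.aestronglyMeasurable (fun x hx => ?_) measurableSet_Ioo) ?_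
      · exact (Real.continuousAt_rpow_const x _ (Or.inl hx.1.ne')).continuousWithinAt
      · refine (ae_restrict_iff' measurableSet_Ioo).2 (ae_of_all _ fun x hx => ?_)
        have hp := Real.rpow_nonneg hx.1.le (s - 1)
        rw [Real.norm_of_nonneg hp, mul_left_comm, ← Real.exp_add]
        refine le_mul_of_one_le_right hp (Real.one_le_exp ?_)
        linarith [hx.2]
    rw [intervalIntegral.integrableOn_Ioo_rpow_iff one_pos] at h1
    linarith
  · simpa [mul_comm] using Real.GammaIntegral_convergent h

/-- The divergent case, with default value `0`, is included because the moment-generating functions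
compared later must agree at every real `s`. -/
lemma integral_rpow_mul_exp_neg (s : ℝ) :
    ∫ x in Ioi (0 : ℝ), x ^ (s - 1) * Real.exp (-x) = if 0 < s then Real.Gamma s else 0 := by
  split_ifs with h
  · rw [Real.Gamma_eq_integral h]
    simp_rw [mul_comm]
  · exact integral_undef fun hi => h (integrableOn_rpow_mul_exp_neg_iff.1 hi)

/-- Lebesgue measure on `(0, ∞)ⁿ × (0, ∞)`. -/
noncomputable def orthantMeasure (n : ℕ) : Measure ((Fin n → ℝ) × ℝ) :=
  (Measure.pi fun _ : Fin n => volume.restrict (Ioi (0 : ℝ))).prod (volume.restrict (Ioi 0))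

instance (n : ℕ) : SigmaFinite (orthantMeasure n) := by
  unfold orthantMeasure; infer_instance

/-- The weight `∏ xₖ ^ ((k + 1) / (n + 1) - 1) e ^ (-xₖ)`. -/
noncomputable def foldWeight (n : ℕ) (x : Fin n → ℝ) : ℝ :=
  ∏ k, (x k ^ ((((k : ℕ) : ℝ) + 1) / ((n + 1 : ℕ) : ℝ) - 1) * Real.exp (-(x k)))

lemma measurable_foldWeight (n : ℕ) : Measurable (foldWeight n) := by
  unfold foldWeight
  fun_prop

lemma ae_pi_pos (n : ℕ) :
    ∀ᵐ x ∂(Measure.pi fun _ : Fin n => volume.restrict (Ioi (0 : ℝ))), ∀ k, 0 < x k := by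
  rw [← Measure.restrict_pi_pi]
  refine (ae_restrict_iff' (MeasurableSet.univ_pi fun _ => measurableSet_Ioi)).2
    (ae_of_all _ fun x hx k => hx k (mem_univ k))

lemma ae_orthantMeasure_pos (n : ℕ) :
    ∀ᵐ q ∂orthantMeasure n, (∀ k, 0 < q.1 k) ∧ 0 < q.2 := by
  have h1 := (Measure.quasiMeasurePreserving_fst (ν := volume.restrict (Ioi (0 : ℝ)))).ae
    (ae_pi_pos n)
  have h2 := (Measure.quasiMeasurePreserving_snd
    (μ := Measure.pi fun _ : Fin n => volume.restrict (Ioi (0 : ℝ)))).ae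
    (ae_restrict_mem (μ := volume) (measurableSet_Ioi (a := (0 : ℝ))))
  filter_upwards [h1, h2] with q hq1 hq2 using ⟨hq1, hq2⟩

/-- The density of `(X₁, …, Xₙ, Y)`, up to normalization. -/
noncomputable def orthantWeight (n : ℕ) (q : (Fin n → ℝ) × ℝ) : ℝ :=
  foldWeight n q.1 * Real.exp (-q.2)

lemma measurable_orthantWeight (n : ℕ) : Measurable (orthantWeight n) := by
  have := measurable_foldWeight n
  unfold orthantWeight
  fun_prop

/-- Passing to the logarithm turns power moments of the product into a moment-generating function.
-/
noncomputable def orthantLog (n : ℕ) (q : (Fin n → ℝ) × ℝ) : ℝ :=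
  Real.log ((∏ k, q.1 k) * q.2)

lemma measurable_orthantLog (n : ℕ) : Measurable (orthantLog n) := by
  unfold orthantLog
  fun_prop

lemma orthantWeight_pos {n : ℕ} {q : (Fin n → ℝ) × ℝ} (hq : ∀ k, 0 < q.1 k) :
    0 < orthantWeight n q :=
  mul_pos (Finset.prod_pos fun k _ => mul_pos (Real.rpow_pos_of_pos (hq k) _) (Real.exp_pos _))
    (Real.exp_pos _)

lemma orthantWeight_mul_exp {n : ℕ} {q : (Fin n → ℝ) × ℝ} (hq : ∀ k, 0 < q.1 k) (hq2 : 0 < q.2)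
    (s : ℝ) : orthantWeight n q * Real.exp (s * orthantLog n q) =
      (∏ k, (q.1 k ^ (s + (((k : ℕ) : ℝ) + 1) / ((n + 1 : ℕ) : ℝ) - 1) * Real.exp (-(q.1 k)))) *
        (q.2 ^ (s + 1 - 1) * Real.exp (-q.2)) := by
  have hP : 0 < ∏ k, q.1 k := Finset.prod_pos fun k _ => hq k
  have e : Real.exp (s * orthantLog n q) = (∏ k, q.1 k ^ s) * q.2 ^ s := by
    rw [orthantLog, mul_comm, ← Real.rpow_def_of_pos (mul_pos hP hq2),
      Real.mul_rpow hP.le hq2.le, Real.finsetProd_rpow _ _ fun k _ => (hq k).le]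
  have e2 : ∏ k, (q.1 k ^ (s + (((k : ℕ) : ℝ) + 1) / ((n + 1 : ℕ) : ℝ) - 1) *
      Real.exp (-(q.1 k))) = (∏ k, q.1 k ^ s) * foldWeight n q.1 := by
    rw [foldWeight, ← Finset.prod_mul_distrib]
    refine Finset.prod_congr rfl fun k _ => ?_
    rw [add_sub_assoc, Real.rpow_add (hq k)]
    ring
  rw [e, e2, orthantWeight, add_sub_cancel_right]
  ring

lemma ae_orthantWeight_mul_exp (n : ℕ) (s : ℝ) :
    (fun q => orthantWeight n q * Real.exp (s * orthantLog n q)) =ᵐ[orthantMeasure n]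
      fun q => (∏ k, (q.1 k ^ (s + (((k : ℕ) : ℝ) + 1) / ((n + 1 : ℕ) : ℝ) - 1) *
        Real.exp (-(q.1 k)))) * (q.2 ^ (s + 1 - 1) * Real.exp (-q.2)) := by
  filter_upwards [ae_orthantMeasure_pos n] with q hq
  exact orthantWeight_mul_exp hq.1 hq.2 s

lemma integrable_orthantWeight_mul_exp {n : ℕ} {s : ℝ} (hs : -(1 / ((n + 1 : ℕ) : ℝ)) < s) :
    Integrable (fun q => orthantWeight n q * Real.exp (s * orthantLog n q))
      (orthantMeasure n) := by
  have hn : (0 : ℝ) < ((n + 1 : ℕ) : ℝ) := by positivity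
  refine Integrable.congr ?_ (ae_orthantWeight_mul_exp n s).symm
  refine Integrable.mul_prod (f := fun x : Fin n → ℝ => ∏ k, (x k ^ (s + (((k : ℕ) : ℝ) + 1) /
    ((n + 1 : ℕ) : ℝ) - 1) * Real.exp (-(x k)))) (g := fun y : ℝ => y ^ (s + 1 - 1) *
      Real.exp (-y)) (Integrable.fintype_prod (f := fun (k : Fin n) (y : ℝ) =>
      y ^ (s + (((k : ℕ) : ℝ) + 1) / ((n + 1 : ℕ) : ℝ) - 1) * Real.exp (-y)) fun k => ?_) ?_
  · refine integrableOn_rpow_mul_exp_neg_iff.2 ?_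
    have : 1 / ((n + 1 : ℕ) : ℝ) ≤ (((k : ℕ) : ℝ) + 1) / ((n + 1 : ℕ) : ℝ) := by
      gcongr
      simp
    linarith
  · refine integrableOn_rpow_mul_exp_neg_iff.2 ?_
    have : 1 / ((n + 1 : ℕ) : ℝ) ≤ 1 := by
      rw [div_le_one hn]
      push_cast
      linarith [(Nat.cast_nonneg n : (0 : ℝ) ≤ n)]
    linarith

/-- By independence this is a product of Gamma values at `s + (k + 1)/(n + 1)`, to which Gauss's
formula applies with `x = 1 + (n + 1)s`. -/
lemma integral_orthantWeight_mul_exp (n : ℕ) (s : ℝ) :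
    ∫ q, orthantWeight n q * Real.exp (s * orthantLog n q) ∂orthantMeasure n =
      if 0 < 1 + ((n + 1 : ℕ) : ℝ) * s then
        (∏ k ∈ Finset.range n, Real.Gamma ((1 + k) / (n + 1 : ℝ))) *
          (((n + 1 : ℕ) : ℝ) ^ (-(((n + 1 : ℕ) : ℝ) * s)) *
            Real.Gamma (1 + ((n + 1 : ℕ) : ℝ) * s))
      else 0 := by
  have hn : (0 : ℝ) < ((n + 1 : ℕ) : ℝ) := by positivity
  rw [integral_congr_ae (ae_orthantWeight_mul_exp n s), orthantMeasure,
    integral_prod_mul (fun x : Fin n → ℝ => ∏ k, (x k ^ (s + (((k : ℕ) : ℝ) + 1) /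
      ((n + 1 : ℕ) : ℝ) - 1) * Real.exp (-(x k)))) (fun y : ℝ => y ^ (s + 1 - 1) * Real.exp (-y)),
    integral_fintype_prod_eq_prod (f := fun (k : Fin n) (y : ℝ) =>
      y ^ (s + (((k : ℕ) : ℝ) + 1) / ((n + 1 : ℕ) : ℝ) - 1) * Real.exp (-y))]
  simp only [integral_rpow_mul_exp_neg]
  -- The exponential variable has shape `1 = (n + 1)/(n + 1)` and supplies the missing factor `k =
  -- n`.
  have hfin : (∏ k : Fin n, if 0 < s + (((k : ℕ) : ℝ) + 1) / ((n + 1 : ℕ) : ℝ) then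
      Real.Gamma (s + (((k : ℕ) : ℝ) + 1) / ((n + 1 : ℕ) : ℝ)) else 0) *
      (if 0 < s + 1 then Real.Gamma (s + 1) else 0) =
      ∏ k ∈ Finset.range (n + 1), if 0 < s + ((k : ℝ) + 1) / ((n + 1 : ℕ) : ℝ) then
        Real.Gamma (s + ((k : ℝ) + 1) / ((n + 1 : ℕ) : ℝ)) else 0 := by
    rw [Finset.prod_range_succ, Finset.prod_range (fun k : ℕ =>
      if 0 < s + ((k : ℝ) + 1) / ((n + 1 : ℕ) : ℝ) then
        Real.Gamma (s + ((k : ℝ) + 1) / ((n + 1 : ℕ) : ℝ)) else 0)]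
    have : ((n : ℝ) + 1) / ((n + 1 : ℕ) : ℝ) = 1 := by
      rw [Nat.cast_succ]; exact div_self (by positivity)
    rw [this]
  rw [hfin]
  split_ifs with hpos
  · have hG := prod_Gamma_add_div (h := n + 1) (by omega) hpos
    rw [Finset.prod_congr rfl (g := fun k : ℕ =>
      Real.Gamma ((1 + ((n + 1 : ℕ) : ℝ) * s + k) / ((n + 1 : ℕ) : ℝ))), hG]
    · rw [Finset.prod_range_succ, sub_add_cancel_left, mul_assoc]
      have : ((1 : ℝ) + n) / ((n + 1 : ℕ) : ℝ) = 1 := by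
        rw [Nat.cast_succ, add_comm]; exact div_self (by positivity)
      rw [this, Real.Gamma_one, mul_one]
      simp only [Nat.cast_succ]
    · intro k _
      have e : s + ((k : ℝ) + 1) / ((n + 1 : ℕ) : ℝ) =
          (1 + ((n + 1 : ℕ) : ℝ) * s + k) / ((n + 1 : ℕ) : ℝ) := by
        field_simp
        ring
      rw [e, if_pos]
      positivity
  -- The factor `k = 0` has the smallest shape, and its argument is a positive multiple of `1 + (n +
  -- 1)s`; it diverges first and carries the default value.
  · refine Finset.prod_eq_zero (Finset.mem_range.2 n.succ_pos) ?_
    rw [if_neg]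
    rw [Nat.cast_zero, zero_add, not_lt] at *
    have : s + 1 / ((n + 1 : ℕ) : ℝ) = (1 + ((n + 1 : ℕ) : ℝ) * s) / ((n + 1 : ℕ) : ℝ) := by
      field_simp
      ring
    rw [this]
    exact div_nonpos_of_nonpos_of_nonneg hpos hn.le

/-! ### Equality of laws through moment-generating functions. -/

section withDensity

variable {α : Type*} [MeasurableSpace α] {μ : Measure α} {w : α → ℝ}
  {E : Type*} [NormedAddCommGroup E] [NormedSpace ℝ E]

lemma toReal_ofReal_smul_ae (hw0 : ∀ᵐ x ∂μ, 0 ≤ w x) (g : α → E) :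
    (fun x => (ENNReal.ofReal (w x)).toReal • g x) =ᵐ[μ] fun x => w x • g x := by
  filter_upwards [hw0] with x hx
  rw [ENNReal.toReal_ofReal hx]

lemma integral_withDensity_ofReal (hw : Measurable w) (hw0 : ∀ᵐ x ∂μ, 0 ≤ w x) (g : α → E) :
    ∫ x, g x ∂(μ.withDensity fun x => ENNReal.ofReal (w x)) = ∫ x, w x • g x ∂μ := by
  rw [integral_withDensity_eq_integral_toReal_smul hw.ennreal_ofReal
    (ae_of_all _ fun _ => ENNReal.ofReal_lt_top)]
  exact integral_congr_ae (toReal_ofReal_smul_ae hw0 g)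

lemma integrable_withDensity_ofReal (hw : Measurable w) (hw0 : ∀ᵐ x ∂μ, 0 ≤ w x) {g : α → E} :
    Integrable g (μ.withDensity fun x => ENNReal.ofReal (w x)) ↔
      Integrable (fun x => w x • g x) μ := by
  rw [integrable_withDensity_iff_integrable_smul' hw.ennreal_ofReal
    (ae_of_all _ fun _ => ENNReal.ofReal_lt_top)]
  exact integrable_congr (toReal_ofReal_smul_ae hw0 g)

end withDensity

open ProbabilityTheory in
/-- Finite measures are determined by the moment-generating function of a random variable,
provided it is finite near `0`. -/
lemma map_eq_map_of_mgf_eq {Ω Ω' : Type*} [MeasurableSpace Ω] [MeasurableSpace Ω']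
    {μ : Measure Ω} {μ' : Measure Ω'} [IsFiniteMeasure μ] [IsFiniteMeasure μ'] {X : Ω → ℝ}
    {Y : Ω' → ℝ} (hX : Measurable X) (hY : Measurable Y) (h : mgf X μ = mgf Y μ')
    (h0 : (0 : ℝ) ∈ interior (integrableExpSet X μ)) : μ.map X = μ'.map Y := by
  have hμμ' : μ = 0 ↔ μ' = 0 := by
    have h1 := congrFun h 0
    rw [mgf_zero', mgf_zero'] at h1
    rw [← Measure.measure_univ_eq_zero, ← Measure.measure_univ_eq_zero,
      ← measureReal_eq_zero_iff, ← measureReal_eq_zero_iff, h1]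
  have := Measure.isFiniteMeasure_map μ X
  have := Measure.isFiniteMeasure_map μ' Y
  -- The characteristic function is the complex moment-generating function on the imaginary axis,
  -- which lies in the strip where the real one determines it.
  refine Measure.ext_of_charFun (funext fun t => ?_)
  rw [← complexMGF_mul_I hX.aemeasurable, ← complexMGF_mul_I hY.aemeasurable]
  refine eqOn_complexMGF_of_mgf' h hμμ' ?_
  simpa using h0

/-- The law of `∏ Xₖ · Y`, where the `Xₖ` are Gamma variables of shape `(k + 1) / (n + 1)` and `Y`
is exponential, is that of `(U / (n + 1)) ^ (n + 1)`, where `U` is exponential. -/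
lemma integral_orthantWeight_smul (n : ℕ) {φ : ℝ → ℂ} (hφ : ContinuousOn φ (Ioi 0)) :
    ∫ q, orthantWeight n q • φ ((∏ k, q.1 k) * q.2) ∂orthantMeasure n =
      ∫ u in Ioi (0 : ℝ), ((∏ k ∈ Finset.range n, Real.Gamma ((1 + k) / (n + 1 : ℝ))) *
        Real.exp (-u)) • φ ((u / ((n + 1 : ℕ) : ℝ)) ^ (n + 1)) := by
  let K : ℝ := ∏ k ∈ Finset.range n, Real.Gamma ((1 + k) / (n + 1 : ℝ))
  have hK : 0 < K := Finset.prod_pos fun k _ => Real.Gamma_pos_of_pos (by positivity)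
  have hn : (0 : ℝ) < ((n + 1 : ℕ) : ℝ) := by positivity
  let A := (orthantMeasure n).withDensity fun q => ENNReal.ofReal (orthantWeight n q)
  let B := (volume.restrict (Ioi (0 : ℝ))).withDensity fun u => ENNReal.ofReal (K * Real.exp (-u))
  -- For `u > 0` this is the logarithm of `(u / (n + 1)) ^ (n + 1)`.
  let Y : ℝ → ℝ := fun u => ((n + 1 : ℕ) : ℝ) * Real.log (u / ((n + 1 : ℕ) : ℝ))
  have hwA : ∀ᵐ q ∂orthantMeasure n, 0 ≤ orthantWeight n q := by
    filter_upwards [ae_orthantMeasure_pos n] with q hq using (orthantWeight_pos hq.1).le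
  have hwB : ∀ᵐ u ∂(volume.restrict (Ioi (0 : ℝ))), 0 ≤ K * Real.exp (-u) :=
    ae_of_all _ fun u => by positivity
  have hmB : Measurable fun u : ℝ => K * Real.exp (-u) := by fun_prop
  have hmY : Measurable Y := by simp only [Y]; fun_prop
  have hmX := measurable_orthantLog n
  have hmA := measurable_orthantWeight n
  have : IsFiniteMeasure A := by
    have h0 := integrable_orthantWeight_mul_exp (n := n) (s := 0)
      (neg_lt_zero.2 (one_div_pos.2 hn))
    simp only [zero_mul, Real.exp_zero, mul_one] at h0
    exact isFiniteMeasure_withDensity_ofReal h0.2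
  have : IsFiniteMeasure B := by
    have h0 : IntegrableOn (fun u : ℝ => K * Real.exp (-u)) (Ioi 0) :=
      (integrableOn_exp_neg_Ioi 0).const_mul K
    exact isFiniteMeasure_withDensity_ofReal h0.2
  have hYexp : ∀ (s u : ℝ), 0 < u → Real.exp (s * Y u) =
      ((n + 1 : ℕ) : ℝ) ^ (-(((n + 1 : ℕ) : ℝ) * s)) * u ^ (1 + ((n + 1 : ℕ) : ℝ) * s - 1) := by
    intro s u hu
    have : s * Y u = Real.log (u / ((n + 1 : ℕ) : ℝ)) * (((n + 1 : ℕ) : ℝ) * s) := by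
      simp only [Y]; ring
    rw [this, ← Real.rpow_def_of_pos (div_pos hu hn), Real.div_rpow hu.le hn.le,
      Real.rpow_neg hn.le, add_sub_cancel_left]
    ring
  have hmap : A.map (orthantLog n) = B.map Y := by
    refine map_eq_map_of_mgf_eq hmX hmY (funext fun s => ?_) ?_
    · have h1 : ProbabilityTheory.mgf Y B s =
          K * (((n + 1 : ℕ) : ℝ) ^ (-(((n + 1 : ℕ) : ℝ) * s)) *
            ∫ u in Ioi (0 : ℝ), u ^ (1 + ((n + 1 : ℕ) : ℝ) * s - 1) * Real.exp (-u)) := by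
        rw [ProbabilityTheory.mgf, integral_withDensity_ofReal hmB hwB, ← integral_const_mul,
          ← integral_const_mul]
        refine setIntegral_congr_fun measurableSet_Ioi fun u hu => ?_
        simp only [smul_eq_mul]
        rw [hYexp s u hu]
        ring
      rw [h1, integral_rpow_mul_exp_neg, ProbabilityTheory.mgf,
        integral_withDensity_ofReal hmA hwA]
      simp only [smul_eq_mul]
      rw [integral_orthantWeight_mul_exp]
      split_ifs
      · rfl
      · simp
    · have hsub : Ioi (-(1 / ((n + 1 : ℕ) : ℝ))) ⊆
          ProbabilityTheory.integrableExpSet (orthantLog n) A := fun s hs => by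
        refine (integrable_withDensity_ofReal hmA hwA).2 ?_
        simpa only [smul_eq_mul] using integrable_orthantWeight_mul_exp hs
      exact interior_mono hsub (by
        rw [interior_Ioi, mem_Ioi]; exact neg_lt_zero.2 (one_div_pos.2 hn))
  -- Composing with `exp` makes the test function continuous on all of `ℝ`, where the two image
  -- measures live.
  have hφe : Continuous fun x : ℝ => φ (Real.exp x) :=
    hφ.comp_continuous Real.continuous_exp fun x => Real.exp_pos x
  have hint : ∫ q, φ (Real.exp (orthantLog n q)) ∂A = ∫ u, φ (Real.exp (Y u)) ∂B := by
    rw [← integral_map hmX.aemeasurable hφe.aestronglyMeasurable, hmap,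
      integral_map hmY.aemeasurable hφe.aestronglyMeasurable]
  rw [integral_withDensity_ofReal hmA hwA, integral_withDensity_ofReal hmB hwB] at hint
  calc _ = ∫ q, orthantWeight n q • φ (Real.exp (orthantLog n q)) ∂orthantMeasure n := by
        refine integral_congr_ae ?_
        filter_upwards [ae_orthantMeasure_pos n] with q hq
        rw [orthantLog, Real.exp_log (mul_pos (Finset.prod_pos fun k _ => hq.1 k) hq.2)]
    _ = _ := by
        rw [hint]
        refine setIntegral_congr_fun measurableSet_Ioi fun u hu => ?_
        have h1 := hYexp 1 u hu
        have hu' : 0 < u := hu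
        rw [one_mul, mul_one, add_sub_cancel_left, Real.rpow_neg hn.le, Real.rpow_natCast,
          Real.rpow_natCast] at h1
        rw [h1, div_pow, div_eq_inv_mul]

/-! ### The multiple integral as a function of `c = (h / p) ^ h`. -/

lemma continuousOn_besselProd {ν : ℂ} (hν : -1 < ν.re) {a b : ℝ} (ha : 0 < a) (hb : 0 < b) :
    ContinuousOn (besselProd ν a b) (Ioi 0) := by
  have hF := continuous_besselEntire hν
  refine ContinuousOn.congr (f := fun s : ℝ => ((a * b / 4 : ℝ) : ℂ) ^ ν * ((s : ℂ) ^ ν *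
      (besselEntire ν (-((a ^ 2 / 4 : ℝ) * (s : ℂ))) *
        besselEntire ν (-((b ^ 2 / 4 : ℝ) * (s : ℂ)))))) ?_ fun s hs => besselProd_eq ν ha hb hs
  exact continuousOn_const.mul ((continuousOn_ofReal_cpow ν).mul
    (Continuous.continuousOn (by fun_prop)))

lemma exp_orthantLog {n : ℕ} {q : (Fin n → ℝ) × ℝ} (hq : ∀ k, 0 < q.1 k) (hq2 : 0 < q.2) :
    Real.exp (orthantLog n q) = (∏ k, q.1 k) * q.2 :=
  Real.exp_log (mul_pos (Finset.prod_pos fun k _ => hq k) hq2)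

/-- The measure on `(0, ∞)ⁿ`. -/
noncomputable abbrev piMeasure (n : ℕ) : Measure (Fin n → ℝ) :=
  Measure.pi fun _ : Fin n => volume.restrict (Ioi (0 : ℝ))

lemma foldWeight_pos {n : ℕ} {x : Fin n → ℝ} (hx : ∀ k, 0 < x k) : 0 < foldWeight n x :=
  Finset.prod_pos fun k _ => mul_pos (Real.rpow_pos_of_pos (hx k) _) (Real.exp_pos _)

lemma integrable_prod_rpow_mul_foldWeight {n : ℕ} {s : ℝ}
    (hs : -(1 / ((n + 1 : ℕ) : ℝ)) < s) :
    Integrable (fun x : Fin n → ℝ => (∏ k, x k) ^ s * foldWeight n x) (piMeasure n) := by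
  refine Integrable.congr (Integrable.fintype_prod (f := fun (k : Fin n) (y : ℝ) =>
    y ^ (s + (((k : ℕ) : ℝ) + 1) / ((n + 1 : ℕ) : ℝ) - 1) * Real.exp (-y)) fun k => ?_) ?_
  · refine integrableOn_rpow_mul_exp_neg_iff.2 ?_
    have : 1 / ((n + 1 : ℕ) : ℝ) ≤ (((k : ℕ) : ℝ) + 1) / ((n + 1 : ℕ) : ℝ) := by
      gcongr
      simp
    linarith
  · filter_upwards [ae_pi_pos n] with x hx
    rw [← Real.finsetProd_rpow _ _ fun k _ => (hx k).le, foldWeight, ← Finset.prod_mul_distrib]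
    refine Finset.prod_congr rfl fun k _ => ?_
    rw [add_sub_assoc, Real.rpow_add (hx k)]
    ring

/-- The integrand of the multiple integral, as a function of the parameter `c = (h / p) ^ h`. -/
noncomputable def kernelFold (ν : ℂ) (a b : ℝ) (n : ℕ) (c : ℂ) (x : Fin n → ℝ) : ℂ :=
  weberKernel ν a b (c * ((∏ k, x k : ℝ) : ℂ)) * ((foldWeight n x : ℝ) : ℂ)

lemma foldIntegrand_eq_kernelFold (ν p : ℂ) (a b : ℝ) (n : ℕ) :
    foldIntegrand ν p a b (n + 1) = kernelFold ν a b n ((((n + 1 : ℕ) : ℂ) / p) ^ (n + 1)) := by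
  funext x
  change besselI ν _ * Complex.exp _ * _ = besselI ν _ * Complex.exp _ * _
  congr 3
  · exact mul_right_comm _ _ _
  · exact congrArg Neg.neg (mul_right_comm _ _ _)

lemma mul_prod_mem {n : ℕ} {x : Fin n → ℝ} (hx : ∀ k, 0 < x k) {c : ℂ} (hc : 0 ≤ c.re)
    (hc0 : c ≠ 0) : 0 ≤ (c * ((∏ k, x k : ℝ) : ℂ)).re ∧ c * ((∏ k, x k : ℝ) : ℂ) ≠ 0 := by
  have hP : 0 < ∏ k, x k := Finset.prod_pos fun k _ => hx k
  refine ⟨?_, mul_ne_zero hc0 (by exact_mod_cast hP.ne')⟩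
  rw [Complex.re_mul_ofReal]
  positivity

lemma aestronglyMeasurable_kernelFold {ν : ℂ} (hν : -1 < ν.re) {a b : ℝ} (ha : 0 < a)
    (hb : 0 < b) (n : ℕ) {c : ℂ} (hc : 0 ≤ c.re) (hc0 : c ≠ 0) :
    AEStronglyMeasurable (kernelFold ν a b n c) (piMeasure n) := by
  refine AEStronglyMeasurable.mul ?_
    (Complex.measurable_ofReal.comp (measurable_foldWeight n)).aestronglyMeasurable
  rw [piMeasure, ← Measure.restrict_pi_pi]
  refine ContinuousOn.aestronglyMeasurable ?_ (MeasurableSet.univ_pi fun _ => measurableSet_Ioi)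
  refine (continuousOn_weberKernel hν ha hb).comp (Continuous.continuousOn (by fun_prop))
    fun x hx => mul_prod_mem (fun k => hx k (mem_univ k)) hc hc0

lemma exists_norm_kernelFold_le {ν : ℂ} (hν : -(1 / 2) < ν.re) {a b : ℝ} (ha : 0 < a)
    (hb : 0 < b) (n : ℕ) : ∃ C : ℝ, 0 < C ∧ ∀ c : ℂ, 0 ≤ c.re → c ≠ 0 → ∀ x : Fin n → ℝ,
      (∀ k, 0 < x k) →
        ‖kernelFold ν a b n c x‖ ≤ C * ‖c‖ ^ ν.re * ((∏ k, x k) ^ ν.re * foldWeight n x) := by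
  obtain ⟨C, hC, h⟩ := exists_norm_weberKernel_le hν ha hb
  refine ⟨C, hC, fun c hc hc0 x hx => ?_⟩
  have hP : 0 < ∏ k, x k := Finset.prod_pos fun k _ => hx k
  have hm := mul_prod_mem hx hc hc0
  have h1 := h _ hm.1 hm.2
  have hw := foldWeight_pos hx
  rw [norm_mul, Complex.norm_real, Real.norm_of_nonneg hP.le,
    Real.mul_rpow (norm_nonneg c) hP.le] at h1
  rw [kernelFold, norm_mul, Complex.norm_real, Real.norm_of_nonneg hw.le]
  calc _ ≤ C * (‖c‖ ^ ν.re * (∏ k, x k) ^ ν.re) * foldWeight n x := by gcongr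
    _ = _ := by ring

lemma integrable_kernelFold {ν : ℂ} (hν : -(1 / 2) < ν.re) {n : ℕ}
    (hνn : -(1 / ((n + 1 : ℕ) : ℝ)) < ν.re) {a b : ℝ} (ha : 0 < a) (hb : 0 < b) {c : ℂ}
    (hc : 0 ≤ c.re) (hc0 : c ≠ 0) : Integrable (kernelFold ν a b n c) (piMeasure n) := by
  obtain ⟨C, hC, h⟩ := exists_norm_kernelFold_le hν ha hb n
  refine Integrable.mono' ((integrable_prod_rpow_mul_foldWeight hνn).const_mul (C * ‖c‖ ^ ν.re))
    (aestronglyMeasurable_kernelFold (by linarith) ha hb n hc hc0) ?_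
  filter_upwards [ae_pi_pos n] with x hx using h c hc hc0 x hx

/-- A bound uniform for `c` near `c₀` in the closed half-plane, so that it serves both holomorphy
inside and continuity up to the boundary. -/
lemma exists_bound_kernelFold {ν : ℂ} (hν : -(1 / 2) < ν.re) {n : ℕ}
    (hνn : -(1 / ((n + 1 : ℕ) : ℝ)) < ν.re) {a b : ℝ} (ha : 0 < a) (hb : 0 < b) {c₀ : ℂ}
    (hc₀ : c₀ ≠ 0) : ∃ V ∈ nhds c₀, ∃ bound : (Fin n → ℝ) → ℝ, Integrable bound (piMeasure n) ∧
      ∀ᵐ x ∂piMeasure n, ∀ c ∈ V, 0 ≤ c.re → c ≠ 0 → ‖kernelFold ν a b n c x‖ ≤ bound x := by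
  obtain ⟨C, hC, h⟩ := exists_norm_kernelFold_le hν ha hb n
  have hcont : ContinuousAt (fun c : ℂ => ‖c‖ ^ ν.re) c₀ :=
    continuousAt_id.norm.rpow_const (Or.inl (norm_ne_zero_iff.2 hc₀))
  refine ⟨{c | ‖c‖ ^ ν.re < ‖c₀‖ ^ ν.re + 1}, hcont.eventually_lt_const (lt_add_one _), _,
    (integrable_prod_rpow_mul_foldWeight hνn).const_mul (C * (‖c₀‖ ^ ν.re + 1)), ?_⟩
  filter_upwards [ae_pi_pos n] with x hx c hcV hc hc0
  have hcV' : ‖c‖ ^ ν.re < ‖c₀‖ ^ ν.re + 1 := hcV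
  refine (h c hc hc0 x hx).trans ?_
  have hP : 0 < ∏ k, x k := Finset.prod_pos fun k _ => hx k
  have hw := foldWeight_pos hx
  have := Real.rpow_nonneg hP.le ν.re
  gcongr

lemma differentiableOn_integral_kernelFold {ν : ℂ} (hν : -(1 / 2) < ν.re) {n : ℕ}
    (hνn : -(1 / ((n + 1 : ℕ) : ℝ)) < ν.re) {a b : ℝ} (ha : 0 < a) (hb : 0 < b) :
    DifferentiableOn ℂ (fun c => ∫ x, kernelFold ν a b n c x ∂piMeasure n)
      {c : ℂ | 0 < c.re} := by
  have ho : IsOpen {c : ℂ | 0 < c.re} := isOpen_lt continuous_const Complex.continuous_re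
  have hne : ∀ c : ℂ, 0 < c.re → c ≠ 0 := fun c hc h0 => by simp [h0] at hc
  refine differentiableOn_integral_of_locally_dominated ho (fun c hc => ?_) ?_ fun c hc => ?_
  · exact aestronglyMeasurable_kernelFold (by linarith) ha hb n (le_of_lt hc) (hne c hc)
  · filter_upwards [ae_pi_pos n] with x hx
    have hP : 0 < ∏ k, x k := Finset.prod_pos fun k _ => hx k
    refine DifferentiableOn.mul_const ?_ _
    refine (differentiableOn_weberKernel (by linarith) ha hb).comp
      (Differentiable.differentiableOn (by fun_prop)) fun c hc => ?_
    have hc' : 0 < c.re := hc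
    simp only [mem_ofPred_eq, Complex.re_mul_ofReal]
    positivity
  · obtain ⟨V, hV, bound, hbi, hb'⟩ := exists_bound_kernelFold hν hνn ha hb (hne c hc)
    refine ⟨V ∩ {c : ℂ | 0 < c.re}, Filter.inter_mem hV (ho.mem_nhds hc), bound, hbi, ?_⟩
    filter_upwards [hb'] with x hx w hw using hx w hw.1 (le_of_lt hw.2) (hne w hw.2)

lemma continuousOn_integral_kernelFold {ν : ℂ} (hν : -(1 / 2) < ν.re) {n : ℕ}
    (hνn : -(1 / ((n + 1 : ℕ) : ℝ)) < ν.re) {a b : ℝ} (ha : 0 < a) (hb : 0 < b) :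
    ContinuousOn (fun c => ∫ x, kernelFold ν a b n c x ∂piMeasure n)
      {c : ℂ | 0 ≤ c.re ∧ c ≠ 0} := by
  intro c hc
  obtain ⟨V, hV, bound, hbi, hb'⟩ := exists_bound_kernelFold hν hνn ha hb hc.2
  refine continuousWithinAt_of_dominated (bound := bound) ?_ ?_ hbi ?_
  · filter_upwards [self_mem_nhdsWithin] with w hw
    exact aestronglyMeasurable_kernelFold (by linarith) ha hb n hw.1 hw.2
  · filter_upwards [self_mem_nhdsWithin, mem_nhdsWithin_of_mem_nhds hV] with w hw hwV
    filter_upwards [hb'] with x hx using hx w hwV hw.1 hw.2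
  · filter_upwards [ae_pi_pos n] with x hx
    refine ContinuousWithinAt.mul ?_ continuousWithinAt_const
    exact ((continuousOn_weberKernel (by linarith) ha hb).comp
      (Continuous.continuousOn (by fun_prop)) fun c hc => mul_prod_mem hx hc.1 hc.2) c hc

/-- The kernel is opened up by `weberKernel_eq_integral`, Fubini merges `y` with the `x_k`, and the
change of law collapses all `n + 1` variables into one. -/
lemma integral_kernelFold_ofReal {ν : ℂ} (hν : -(1 / 2) < ν.re) {n : ℕ}
    (hνn : -(1 / ((n + 1 : ℕ) : ℝ)) < ν.re) {a b : ℝ} (ha : 0 < a) (hb : 0 < b) {c : ℝ}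
    (hc : 0 < c) :
    ∫ x, kernelFold ν a b n c x ∂piMeasure n =
      ∫ u in Ioi (0 : ℝ), ((∏ k ∈ Finset.range n, Real.Gamma ((1 + k) / (n + 1 : ℝ))) *
        Real.exp (-u)) • besselProd ν a b (c * (u / ((n + 1 : ℕ) : ℝ)) ^ (n + 1)) := by
  obtain ⟨C, hC, hbd⟩ := exists_norm_besselProd_le hν ha hb
  have hν1 : -1 < ν.re := by linarith
  let φ : ℝ → ℂ := fun s => besselProd ν a b (c * s)
  have hφ : ContinuousOn φ (Ioi 0) :=
    (continuousOn_besselProd hν1 ha hb).comp (Continuous.continuousOn (by fun_prop))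
      fun s hs => mul_pos hc hs
  have hφe : Continuous fun x : ℝ => φ (Real.exp x) :=
    hφ.comp_continuous Real.continuous_exp fun x => Real.exp_pos x
  have hI : Integrable (fun q => orthantWeight n q • φ ((∏ k, q.1 k) * q.2))
      (orthantMeasure n) := by
    have hI' : Integrable (fun q => orthantWeight n q • φ (Real.exp (orthantLog n q)))
        (orthantMeasure n) := by
      refine Integrable.mono' ((integrable_orthantWeight_mul_exp hνn).const_mul (C * c ^ ν.re))
        ((measurable_orthantWeight n).aestronglyMeasurable.smul
          (hφe.comp_aestronglyMeasurable (measurable_orthantLog n).aestronglyMeasurable)) ?_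
      filter_upwards [ae_orthantMeasure_pos n] with q hq
      have hw := orthantWeight_pos hq.1
      have h1 := hbd (c * Real.exp (orthantLog n q)) (by positivity)
      rw [Real.mul_rpow hc.le (Real.exp_pos _).le, ← Real.exp_mul, mul_comm _ ν.re] at h1
      rw [norm_smul, Real.norm_of_nonneg hw.le]
      calc _ ≤ orthantWeight n q * (C * (c ^ ν.re * Real.exp (ν.re * orthantLog n q))) := by
            gcongr
        _ = _ := by ring
    refine hI'.congr ?_
    filter_upwards [ae_orthantMeasure_pos n] with q hq
    rw [exp_orthantLog hq.1 hq.2]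
  rw [← integral_orthantWeight_smul n hφ, orthantMeasure, integral_prod _ hI]
  refine integral_congr_ae ?_
  filter_upwards [ae_pi_pos n] with x hx
  have hP : 0 < ∏ k, x k := Finset.prod_pos fun k _ => hx k
  rw [kernelFold, ← Complex.ofReal_mul, ← weberKernel_eq_integral hν1 ha hb (mul_pos hc hP),
    ← integral_mul_const]
  refine integral_congr_ae (ae_of_all _ fun y => ?_)
  simp only [φ, orthantWeight, Complex.real_smul]
  push_cast
  rw [mul_assoc c]
  ring

/-! ### The generalized Weber integral as a Laplace transform, and continuation in `p`. -/

lemma weberIntegrand_eq_comp_sq (ν p : ℂ) (a b : ℝ) (h : ℕ) {x : ℝ} (hx : 0 < x) :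
    weberIntegrand ν p a b h x = (1 / 2 : ℂ) * (((2 : ℝ) * x ^ ((2 : ℝ) - 1)) •
      (Complex.exp (-(p * ((x ^ (2 : ℝ) : ℝ) : ℂ))) *
        besselProd ν a b ((x ^ (2 : ℝ)) ^ h))) := by
  have hs : √((x ^ (2 : ℝ)) ^ h) = x ^ h := by
    rw [Real.rpow_two, ← pow_mul, mul_comm, pow_mul, Real.sqrt_sq (by positivity)]
  rw [besselProd, hs, Real.rpow_two, show (2 : ℝ) - 1 = 1 by norm_num, Real.rpow_one,
    Complex.real_smul, weberIntegrand]
  push_cast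
  rw [neg_mul]
  ring

lemma weberIntegral_eq_laplace (ν p : ℂ) (a b : ℝ) (h : ℕ) :
    weberIntegral ν p a b h = (1 / 2 : ℂ) *
      ∫ u in Ioi (0 : ℝ), Complex.exp (-(p * u)) * besselProd ν a b (u ^ h) := by
  rw [← integral_comp_rpow_Ioi_of_pos (g := fun u : ℝ =>
    Complex.exp (-(p * u)) * besselProd ν a b (u ^ h)) two_pos, ← integral_const_mul]
  exact setIntegral_congr_fun measurableSet_Ioi fun x hx => weberIntegrand_eq_comp_sq ν p a b h hx

lemma integrableOn_weberIntegrand {ν p : ℂ} {a b : ℝ} {h : ℕ}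
    (hi : IntegrableOn (fun u : ℝ => Complex.exp (-(p * u)) * besselProd ν a b (u ^ h))
      (Ioi 0)) : IntegrableOn (weberIntegrand ν p a b h) (Ioi 0) := by
  have h1 := ((integrableOn_Ioi_comp_rpow_iff _ two_ne_zero).2 hi).const_mul (1 / 2 : ℂ)
  rw [abs_of_pos two_pos] at h1
  exact IntegrableOn.congr_fun h1 (fun x hx => (weberIntegrand_eq_comp_sq ν p a b h hx).symm)
    measurableSet_Ioi

lemma aestronglyMeasurable_besselProd_pow {ν : ℂ} (hν : -1 < ν.re) {a b : ℝ} (ha : 0 < a)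
    (hb : 0 < b) (h : ℕ) :
    AEStronglyMeasurable (fun u : ℝ => besselProd ν a b (u ^ h)) (volume.restrict (Ioi 0)) :=
  ContinuousOn.aestronglyMeasurable ((continuousOn_besselProd hν ha hb).comp
    (Continuous.continuousOn (by fun_prop)) fun _ hu => pow_pos (mem_Ioi.1 hu) h) measurableSet_Ioi

lemma integrableOn_exp_mul_besselProd_pow {ν : ℂ} (hν : -(1 / 2) < ν.re) {h : ℕ}
    (hνh : -1 < (h : ℝ) * ν.re) {a b : ℝ} (ha : 0 < a) (hb : 0 < b) {p : ℝ} (hp : 0 < p) :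
    IntegrableOn (fun u : ℝ => Complex.exp (-((p : ℂ) * u)) * besselProd ν a b (u ^ h))
      (Ioi 0) := by
  obtain ⟨C, hC, hbd⟩ := exists_norm_besselProd_le hν ha hb
  refine Integrable.mono' ((integrableOn_rpow_mul_exp_neg hνh hp).const_mul C)
    ((aestronglyMeasurable_exp_neg_mul p _).mul
      (aestronglyMeasurable_besselProd_pow (by linarith) ha hb h)) ?_
  refine (ae_restrict_iff' measurableSet_Ioi).2 (ae_of_all _ fun u hu => ?_)
  have hu' : 0 < u := hu
  have h1 := hbd (u ^ h) (pow_pos hu' h)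
  rw [← Real.rpow_natCast, ← Real.rpow_mul hu'.le, Real.rpow_natCast] at h1
  rw [norm_mul, norm_exp_neg_mul_ofReal, Complex.ofReal_re]
  calc _ ≤ Real.exp (-(p * u)) * (C * u ^ ((h : ℝ) * ν.re)) := by gcongr
    _ = _ := by ring

/-- The constant `∏ Γ(k / h)`. -/
noncomputable def gaussConst (n : ℕ) : ℝ :=
  ∏ k ∈ Finset.range n, Real.Gamma ((1 + k) / (n + 1 : ℝ))

lemma gaussConst_pos (n : ℕ) : 0 < gaussConst n :=
  Finset.prod_pos fun k _ => Real.Gamma_pos_of_pos (by positivity)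

lemma inv_gaussConst (n : ℕ) : (gaussConst n)⁻¹ =
    (2 * Real.pi) ^ ((1 - ((n + 1 : ℕ) : ℝ)) / 2) * ((n + 1 : ℕ) : ℝ) ^ (1 / 2 : ℝ) := by
  have hpi := Real.pi_pos
  rw [gaussConst, prod_Gamma_div, mul_inv, ← Real.rpow_neg (by positivity),
    ← Real.rpow_neg (by positivity), neg_neg]
  congr 2
  · push_cast
    ring
  · push_cast
    ring

/-- Replacing `u` by `pu` explains the choice of `c`: `(h/p)^h (pu/h)^h = u^h`. -/
lemma laplace_mul_eq_kernelFold_ofReal {ν : ℂ} (hν : -(1 / 2) < ν.re) {n : ℕ}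
    (hνn : -(1 / ((n + 1 : ℕ) : ℝ)) < ν.re) {a b : ℝ} (ha : 0 < a) (hb : 0 < b) {p : ℝ}
    (hp : 0 < p) :
    (∫ u in Ioi (0 : ℝ), Complex.exp (-((p : ℂ) * u)) * besselProd ν a b (u ^ (n + 1))) *
      ((gaussConst n : ℂ) * p) =
      ∫ x, kernelFold ν a b n ((((n + 1 : ℕ) : ℂ) / p) ^ (n + 1)) x ∂piMeasure n := by
  have hn : (0 : ℝ) < ((n + 1 : ℕ) : ℝ) := by positivity
  have hc : 0 < (((n + 1 : ℕ) : ℝ) / p) ^ (n + 1) := by positivity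
  have h1 := integral_kernelFold_ofReal hν hνn ha hb hc
  have e : (((((n + 1 : ℕ) : ℝ) / p) ^ (n + 1) : ℝ) : ℂ) =
      (((n + 1 : ℕ) : ℂ) / p) ^ (n + 1) := by push_cast; ring
  rw [e] at h1
  have h2 := integral_comp_mul_left_Ioi (fun u : ℝ => (gaussConst n * Real.exp (-u)) •
    besselProd ν a b ((((n + 1 : ℕ) : ℝ) / p) ^ (n + 1) *
      (u / ((n + 1 : ℕ) : ℝ)) ^ (n + 1))) 0 hp
  rw [mul_zero] at h2
  rw [h1, ← integral_mul_const]
  change _ = ∫ u in Ioi (0 : ℝ), (gaussConst n * Real.exp (-u)) •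
    besselProd ν a b ((((n + 1 : ℕ) : ℝ) / p) ^ (n + 1) * (u / ((n + 1 : ℕ) : ℝ)) ^ (n + 1))
  have h3 := (eq_inv_smul_iff₀ hp.ne').1 h2
  rw [← h3, ← integral_smul]
  refine setIntegral_congr_fun measurableSet_Ioi fun u _ => ?_
  have e2 : (((n + 1 : ℕ) : ℝ) / p) ^ (n + 1) * (p * u / ((n + 1 : ℕ) : ℝ)) ^ (n + 1) =
      u ^ (n + 1) := by
    rw [← mul_pow]
    congr 1
    field_simp
  simp only [e2, Complex.real_smul]
  push_cast
  ring

lemma pow_div_exp_re (n : ℕ) (w : ℂ) :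
    ((((n + 1 : ℕ) : ℂ) / Complex.exp w) ^ (n + 1)).re =
      ((n + 1 : ℕ) : ℝ) ^ (n + 1) * (Real.exp (-(((n + 1 : ℕ) : ℝ) * w.re)) *
        Real.cos (((n + 1 : ℕ) : ℝ) * w.im)) := by
  have : (((n + 1 : ℕ) : ℂ) / Complex.exp w) ^ (n + 1) =
      ((((n + 1 : ℕ) : ℝ) ^ (n + 1) : ℝ) : ℂ) * Complex.exp (-(((n + 1 : ℕ) : ℂ) * w)) := by
    rw [div_pow, ← Complex.exp_nat_mul, Complex.exp_neg, div_eq_mul_inv]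
    push_cast
    ring
  rw [this, Complex.re_ofReal_mul, Complex.exp_re]
  have h1 : (-(((n + 1 : ℕ) : ℂ) * w)).re = -(((n + 1 : ℕ) : ℝ) * w.re) := by simp
  have h2 : (-(((n + 1 : ℕ) : ℂ) * w)).im = -(((n + 1 : ℕ) : ℝ) * w.im) := by simp
  rw [h1, h2, Real.cos_neg]

/-- The identity between the Laplace transform and the multiple integral, on the closed sector,
in the logarithmic coordinate `w = log p`. -/
lemma laplace_mul_eq_kernelFold {ν : ℂ} {n : ℕ} (hn1 : 1 ≤ n)
    (hνn : -(1 / ((n + 1 : ℕ) : ℝ)) < ν.re) {a b : ℝ} (ha : 0 < a) (hb : 0 < b) :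
    EqOn (fun w : ℂ => (∫ u in Ioi (0 : ℝ), Complex.exp (-(Complex.exp w * u)) *
        besselProd ν a b (u ^ (n + 1))) * ((gaussConst n : ℂ) * Complex.exp w))
      (fun w : ℂ => ∫ x, kernelFold ν a b n
        ((((n + 1 : ℕ) : ℂ) / Complex.exp w) ^ (n + 1)) x ∂piMeasure n)
      (Complex.im ⁻¹' Icc (-(Real.pi / 2 / ((n + 1 : ℕ) : ℝ))) (Real.pi / 2 / ((n + 1 : ℕ) : ℝ))) := by
  have hn : (0 : ℝ) < ((n + 1 : ℕ) : ℝ) := by positivity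
  have hn2 : (2 : ℝ) ≤ ((n + 1 : ℕ) : ℝ) := by exact_mod_cast (by omega : 2 ≤ n + 1)
  have hν : -(1 / 2) < ν.re := by
    have : 1 / ((n + 1 : ℕ) : ℝ) ≤ 1 / 2 := by gcongr
    linarith
  have hνh : -1 < ((n + 1 : ℕ) : ℝ) * ν.re := by
    rw [neg_lt, ← sub_pos] at hνn
    have := mul_pos hn hνn
    rw [mul_sub, mul_one_div_cancel hn.ne'] at this
    linarith
  let θ : ℝ := Real.pi / 2 / ((n + 1 : ℕ) : ℝ)
  have hθ : 0 < θ := by have := Real.pi_pos; positivity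
  have hnθ : ((n + 1 : ℕ) : ℝ) * θ = Real.pi / 2 := by simp only [θ]; field_simp
  -- Because `n + 1 ≥ 2`, even the closed strip is mapped by `exp` into `Re p > 0`, so the Laplace
  -- side stays holomorphic on its boundary; only the kernel side is merely continuous there.
  have hθ2 : θ < Real.pi / 2 := by nlinarith
  have hL := differentiableOn_laplace (f := fun u : ℝ => besselProd ν a b (u ^ (n + 1)))
    (fun ε hε => integrableOn_exp_mul_besselProd_pow hν hνh ha hb hε)
    (aestronglyMeasurable_besselProd_pow (by linarith) ha hb (n + 1))
  have hp : ∀ w ∈ Complex.im ⁻¹' Icc (-θ) θ, 0 < (Complex.exp w).re := fun w hw => by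
    rw [Complex.exp_re]
    exact mul_pos (Real.exp_pos _) (Real.cos_pos_of_mem_Ioo
      ⟨by linarith [hw.1], by linarith [hw.2]⟩)
  have hc0 : ∀ w : ℂ, (((n + 1 : ℕ) : ℂ) / Complex.exp w) ^ (n + 1) ≠ 0 := fun w =>
    pow_ne_zero _ (div_ne_zero (by exact_mod_cast n.succ_ne_zero) (Complex.exp_ne_zero w))
  have hc : ∀ w ∈ Complex.im ⁻¹' Icc (-θ) θ,
      0 ≤ ((((n + 1 : ℕ) : ℂ) / Complex.exp w) ^ (n + 1)).re := fun w hw => by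
    rw [pow_div_exp_re]
    have : 0 ≤ Real.cos (((n + 1 : ℕ) : ℝ) * w.im) := Real.cos_nonneg_of_mem_Icc
      ⟨by nlinarith [hw.1], by nlinarith [hw.2]⟩
    positivity
  have hc' : ∀ w ∈ Complex.im ⁻¹' Ioo (-θ) θ,
      0 < ((((n + 1 : ℕ) : ℂ) / Complex.exp w) ^ (n + 1)).re := fun w hw => by
    rw [pow_div_exp_re]
    have : 0 < Real.cos (((n + 1 : ℕ) : ℝ) * w.im) := Real.cos_pos_of_mem_Ioo
      ⟨by nlinarith [hw.1], by nlinarith [hw.2]⟩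
    positivity
  have hsub : Complex.im ⁻¹' Ioo (-θ) θ ⊆ Complex.im ⁻¹' Icc (-θ) θ :=
    preimage_mono Ioo_subset_Icc_self
  have hcd : Differentiable ℂ fun w : ℂ => (((n + 1 : ℕ) : ℂ) / Complex.exp w) ^ (n + 1) :=
    fun w => ((differentiableAt_const _).div Complex.differentiableAt_exp
      (Complex.exp_ne_zero w)).pow _
  have ho : IsOpen (Complex.im ⁻¹' Ioo (-θ) θ) := isOpen_Ioo.preimage Complex.continuous_im
  have hcl : Complex.im ⁻¹' Icc (-θ) θ ⊆ closure (Complex.im ⁻¹' Ioo (-θ) θ) := by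
    rw [Complex.closure_preimage_im, closure_Ioo (by linarith)]
  have hLcomp : DifferentiableOn ℂ (fun w : ℂ => (∫ u in Ioi (0 : ℝ),
      Complex.exp (-(Complex.exp w * u)) * besselProd ν a b (u ^ (n + 1))) *
        ((gaussConst n : ℂ) * Complex.exp w)) (Complex.im ⁻¹' Icc (-θ) θ) :=
    (hL.comp Complex.differentiable_exp.differentiableOn hp).mul
      (Differentiable.differentiableOn (by fun_prop))
  refine EqOn.of_subset_closure (s := Complex.im ⁻¹' Ioo (-θ) θ) ?_ hLcomp.continuousOn
    ((continuousOn_integral_kernelFold hν hνn ha hb).comp hcd.continuous.continuousOn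
      fun w hw => ⟨hc w hw, hc0 w⟩) hsub hcl
  refine ((hLcomp.mono hsub).analyticOnNhd ho).eqOn_of_preconnected_of_frequently_eq
    (((differentiableOn_integral_kernelFold hν hνn ha hb).comp hcd.differentiableOn
      hc').analyticOnNhd ho) ?_ (z₀ := ((0 : ℝ) : ℂ)) ?_ ?_
  -- In the coordinate `w` the sector is a convex strip, and the positive reals `p` form the real
  -- axis, with base point `w = 0` at `p = 1`.
  · exact ((convex_Ioo (-θ) θ).linear_preimage Complex.imLm).isPreconnected
  · simp [hθ]
  · refine frequently_eq_of_eventually_eq_ofReal (Filter.Eventually.of_forall fun x => ?_)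
    have := laplace_mul_eq_kernelFold_ofReal hν hνn ha hb (Real.exp_pos x)
    rw [Complex.ofReal_exp] at this
    exact this

/-! ### Assembling the cases `h ≥ 2` and `h = 1`. -/

lemma restrict_orthant_eq_piMeasure (n : ℕ) :
    (volume : Measure (Fin n → ℝ)).restrict {x | ∀ k, 0 < x k} = piMeasure n := by
  have : {x : Fin n → ℝ | ∀ k, 0 < x k} = Set.univ.pi fun _ => Ioi (0 : ℝ) := by
    ext x
    simp
  rw [this, volume_pi, Measure.restrict_pi_pi]

lemma weber_of_two_le {n : ℕ} (hn1 : 1 ≤ n) {a b : ℝ} (ha : 0 < a) (hb : 0 < b)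
    {p : ℂ} (hp : 0 < p.re) (hparg : ((n + 1 : ℕ) : ℝ) * |p.arg| ≤ Real.pi / 2)
    {ν : ℂ} (hν : -(1 / ((n + 1 : ℕ) : ℝ)) < ν.re) :
    IntegrableOn (weberIntegrand ν p a b (n + 1)) (Ioi (0 : ℝ)) ∧
    IntegrableOn (foldIntegrand ν p a b (n + 1)) {x : Fin n → ℝ | ∀ k, 0 < x k} ∧
    weberIntegral ν p a b (n + 1) = (((gaussConst n)⁻¹ : ℝ) : ℂ) / (2 * p) *
      ∫ x in {x : Fin n → ℝ | ∀ k, 0 < x k}, foldIntegrand ν p a b (n + 1) x := by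
  have hn : (0 : ℝ) < ((n + 1 : ℕ) : ℝ) := by positivity
  have hn2 : (2 : ℝ) ≤ ((n + 1 : ℕ) : ℝ) := by exact_mod_cast (by omega : 2 ≤ n + 1)
  have hν2 : -(1 / 2) < ν.re := by
    have : 1 / ((n + 1 : ℕ) : ℝ) ≤ 1 / 2 := by gcongr
    linarith
  have hνh : -1 < ((n + 1 : ℕ) : ℝ) * ν.re := by
    have h1 := hν
    rw [neg_lt, ← sub_pos] at h1
    have := mul_pos hn h1
    rw [mul_sub, mul_one_div_cancel hn.ne'] at this
    linarith
  have hp0 : p ≠ 0 := fun h => by simp [h] at hp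
  have hw : Complex.exp (Complex.log p) = p := Complex.exp_log hp0
  have harg : |p.arg| ≤ Real.pi / 2 / ((n + 1 : ℕ) : ℝ) := by
    rw [le_div_iff₀ hn]
    linarith
  have hmem : Complex.log p ∈ Complex.im ⁻¹' Icc (-(Real.pi / 2 / ((n + 1 : ℕ) : ℝ)))
      (Real.pi / 2 / ((n + 1 : ℕ) : ℝ)) := by
    rw [mem_preimage, Complex.log_im, mem_Icc, ← abs_le]
    exact harg
  have hcre : 0 ≤ ((((n + 1 : ℕ) : ℂ) / p) ^ (n + 1)).re := by
    rw [← hw, pow_div_exp_re, Complex.log_im]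
    have h1 : |((n + 1 : ℕ) : ℝ) * p.arg| ≤ Real.pi / 2 := by
      rw [abs_mul, abs_of_pos hn]; exact hparg
    have : 0 ≤ Real.cos (((n + 1 : ℕ) : ℝ) * p.arg) :=
      Real.cos_nonneg_of_mem_Icc (abs_le.1 h1)
    positivity
  have hc0 : (((n + 1 : ℕ) : ℂ) / p) ^ (n + 1) ≠ 0 :=
    pow_ne_zero _ (div_ne_zero (by exact_mod_cast n.succ_ne_zero) hp0)
  have hkey := laplace_mul_eq_kernelFold hn1 hν ha hb hmem
  simp only [hw] at hkey
  refine ⟨integrableOn_weberIntegrand (integrableOn_laplace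
    (fun ε hε => integrableOn_exp_mul_besselProd_pow hν2 hνh ha hb hε)
    (aestronglyMeasurable_besselProd_pow (by linarith) ha hb (n + 1)) hp), ?_, ?_⟩
  · have hi := integrable_kernelFold hν2 hν ha hb hcre hc0
    rw [← restrict_orthant_eq_piMeasure, ← foldIntegrand_eq_kernelFold] at hi
    exact hi
  · rw [restrict_orthant_eq_piMeasure, foldIntegrand_eq_kernelFold, weberIntegral_eq_laplace,
      ← hkey]
    have hK : (gaussConst n : ℂ) ≠ 0 := by exact_mod_cast (gaussConst_pos n).ne'
    push_cast
    field_simp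

/-- Kept separate because `Re ν` may lie in `(-1, -1/2]`, where the Poisson bounds are unavailable.
-/
lemma weber_one {a b : ℝ} (ha : 0 < a) (hb : 0 < b) {p : ℂ} (hp : 0 < p.re) {ν : ℂ}
    (hν : -1 < ν.re) :
    IntegrableOn (weberIntegrand ν p a b 1) (Ioi (0 : ℝ)) ∧
    weberIntegral ν p a b 1 = 1 / (2 * p) * weberKernel ν a b (1 / p) := by
  have hi := integrableOn_exp_mul_besselProd hν ha hb hp
  have he := integral_exp_mul_besselProd hν ha hb hp
  refine ⟨integrableOn_weberIntegrand (by simpa only [pow_one] using hi), ?_⟩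
  rw [weberIntegral_eq_laplace]
  simp only [pow_one]
  rw [he]
  ring

theorem mainTheorem3 (h : ℕ) (hh : 1 ≤ h) (a b : ℝ) (ha : 0 < a) (hb : 0 < b)
    (p : ℂ) (hp : 0 < p.re) (hparg : (h : ℝ) * |p.arg| ≤ Real.pi / 2)
    (ν : ℂ) (hν : -(1 / (h : ℝ)) < ν.re) :
    IntegrableOn (weberIntegrand ν p a b h) (Ioi (0 : ℝ)) ∧
    IntegrableOn (foldIntegrand ν p a b h) {x : Fin (h - 1) → ℝ | ∀ k, 0 < x k} ∧
    weberIntegral ν p a b h =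
      (((2 * Real.pi) ^ ((1 - (h : ℝ)) / 2) * (h : ℝ) ^ (1 / 2 : ℝ) : ℝ) : ℂ) / (2 * p) *
        ∫ x in {x : Fin (h - 1) → ℝ | ∀ k, 0 < x k}, foldIntegrand ν p a b h x ∧
    (h = 1 →
      ∫ x in Ioi (0 : ℝ), (x : ℂ) * Complex.exp (-p * (x : ℂ) ^ 2) *
          besselJ ν ((a * x : ℝ) : ℂ) * besselJ ν ((b * x : ℝ) : ℂ) =
        1 / (2 * p) * Complex.exp (-(((a : ℂ) ^ 2 + (b : ℂ) ^ 2) / (4 * p))) *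
          besselI ν ((a : ℂ) * b / (2 * p))) := by
  obtain ⟨n, rfl⟩ : ∃ n, h = n + 1 := ⟨h - 1, by omega⟩
  rw [← inv_gaussConst]
  rcases Nat.eq_zero_or_pos n with rfl | hn
  · have hν1 : -1 < ν.re := by simpa using hν
    obtain ⟨h1, h2⟩ := weber_one ha hb hp hν1
    refine ⟨h1, ?_, ?_, fun _ => ?_⟩
    · change Integrable _ ((volume : Measure (Fin 0 → ℝ)).restrict {x | ∀ k, 0 < x k})
      -- On `Fin 0 → ℝ` the product measure is a Dirac mass, so the `0`-fold integral is evaluation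
      -- of the integrand.
      rw [restrict_orthant_eq_piMeasure, piMeasure, Measure.pi_of_empty]
      exact integrable_dirac (by simp)
    · rw [h2]
      change _ = _ * ∫ x, foldIntegrand ν p a b (0 + 1) x ∂((volume : Measure (Fin 0 → ℝ)).restrict
        {x | ∀ k, 0 < x k})
      rw [restrict_orthant_eq_piMeasure, piMeasure, Measure.pi_of_empty, integral_dirac,
        foldIntegrand_eq_kernelFold]
      simp [gaussConst, kernelFold, foldWeight]
    · have h3 : ∫ x in Ioi (0 : ℝ), (x : ℂ) * Complex.exp (-p * (x : ℂ) ^ 2) *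
          besselJ ν ((a * x : ℝ) : ℂ) * besselJ ν ((b * x : ℝ) : ℂ) =
          weberIntegral ν p a b (0 + 1) := by
        simp only [weberIntegral, weberIntegrand, zero_add, pow_one]
      have e1 : 1 / p * ((a : ℂ) * b / 2) = (a : ℂ) * b / (2 * p) := by
        simp only [div_eq_mul_inv, mul_inv]; ring
      have e2 : 1 / p * (((a : ℂ) ^ 2 + (b : ℂ) ^ 2) / 4) =
          ((a : ℂ) ^ 2 + (b : ℂ) ^ 2) / (4 * p) := by
        simp only [div_eq_mul_inv, mul_inv]; ring
      rw [h3, h2, weberKernel, e1, e2]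
      ring
  · obtain ⟨h1, h2, h3⟩ := weber_of_two_le hn ha hb hp hparg hν
    exact ⟨h1, h2, h3, fun h0 => absurd h0 (by omega)⟩
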